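/- **Setting.** Consider the system $\dot x=f(x)-\Delta(x)^\top\theta+B(x)u$ with $x\in\mathbb R^n$, $u\in\mathbb R^m$, unknown constant $\theta\in\mathbb R^p$, and $B$ with columns $b_1,\dots,b_m$; $f$ and the $b_i$ are $C^1$. Norms are Euclidean. Suppose: 1. (Matched uncertainty) $\Delta(x)^\top\theta=B(x)\varphi(x)^\top\theta$ for all $x$, where $\varphi(x)\in\mathbb R^{p\times m}$ has columns $\varphi_1(x),\dots,\varphi_m(x)$. 2. (Existing CCM) $M(x,t)$ is a $C^1$ field of symmetric matrices with $\alpha_1 I\preceq M\preceq\alpha_2 I$, $\alpha_1>0$, which is a control contraction metric with rate $\lambda>0$ for the nominal system $\dot x=f(x)+B(x)u$: for all $t\ge 0$, $x$, $u$, $\delta$, $$\delta^\top MB=0\ \Longrightarrow\ \delta^\top\big(A^\top M+MA+\dot M+2\lambda M\big)\delta\le 0,$$ where $A(x,u)=\frac{\partial f}{\partial x}+\sum_i u_i\frac{\partial b_i}{\partial x}$ and $\dot M=\frac{\partial M}{\partial t}+\sum_j\frac{\partial M}{\partial x_j}\,(f+Bu)_j$. 3. (Bounded parameters) $\theta_k^-\le\theta_k\le\theta_k^+$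 for every $k$. For a curve $c\in C^1([0,1],\mathbb R^n)$ let $L(c,t)=\int_0^1\sqrt{c_s^\top M(c,t)c_s}\,ds$ and $E(c,t)=\int_0^1 c_s^\top M(c,t)c_s\,ds$; let $d(p,q,t)$ be the infimum of $L(c,t)$ over the curves with $c(0)=p$, $c(1)=q$, and let $E(p,q,t)=d(p,q,t)^2$. A minimal geodesic from $p$ to $q$ at time $t$ is such a curve $\gamma$ with $E(\gamma,t)=L(\gamma,t)^2$ and $L(\gamma,t)\le L(c,t)$ for all such $c$. Let $\delta_u(t,x,\delta,u)$ be a differential controller for the nominal system, i.e. $\delta^\top(A^\top M+MA+\dot M)\delta+2\delta^\top MB\,\delta_u\le-2\lambda\,\delta^\top M\delta$ for all $t\ge0,x,\delta,u$. Let $(x_d,u_d)$ satisfy $\dot x_d=f(x_d)+B(x_d)u_d$ on $[0,T)$. At each time $t$, let $\gamma=\gamma(t,\cdot)$ be a minimal geodesic from $x_d(t)$ to $x(t)$, and let the baseline control be $u_{ccm}=\nu(1)$, where $\nu(s)=u_d+\int_0^s\delta_u(t,\gamma(r),\gamma_s(r),\nu(r))\,dr$ on $[0,1]$ with integrable integrand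 (so $u_{ccm}=u_d+\int_0^1\delta_u\,ds$ if $\delta_u$ does not depend on $u$). Let $\hat\theta(t)$ be an estimate with $\theta_k^-\le\hat\theta_k(t)\le\theta_k^+$, and let $\kappa>0$. **Claim.** Let $x$ be a solution on $[0,T)$ of the uncertain system under the control $$u_i=u_{ccm,i}+\varphi_i(x)^\top\hat\theta-\kappa\,b_i(x)^\top M(\gamma(1),t)\,\gamma_s(1)\,\|\varphi_i(x)\|^2,\qquad i=1,\dots,m.$$ (Solutions, including $x_d$, are continuous functions that satisfy the differential equation with right derivatives at every time in $[0,T)$.) Put $E(t)=E(x_d(t),x(t),t)$, $K=\frac{m}{2\kappa}$ and $\tilde\theta_\infty=\theta^+-\theta^-$. Then for all $t\in[0,T)$ $$\dot E(t)\le-2\lambda E(t)+K\|\tilde\theta_\infty\|^2,$$ where $\dot E$ is the upper right Dini derivative (hence the right derivative or the derivative wherever it exists). Consequently, for all $t\in[0,T)$, the Riemannian energy is exponentially bounded, $$E(t)\le E(0)e^{-2\lambda t}+\frac{K\|\tilde\theta_\infty\|^2}{2\lambda}\big(1-e^{-2\lambda t}\big),$$ and so is the tracking error, $$\|x(t)-x_d(t)\|\le\sqrt{\tfrac{\alpha_2}{\alpha_1}}\,\|x(0)-x_d(0)\|e^{-\lambda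 t}+\sqrt{\tfrac1{\alpha_1}}\sqrt{\tfrac{K}{2\lambda}}\,\|\tilde\theta_\infty\|\big(1-e^{-2\lambda t}\big)^{1/2}.$$ -/

import Mathlib

open Set Filter Topology MeasureTheory

noncomputable section

/-- Column vectors in `ℝⁿ`, with the Euclidean norm and inner product. -/
abbrev Vec (n : ℕ) : Type := EuclideanSpace ℝ (Fin n)

/-! ### Riemannian geometry of a (possibly time-varying) metric on `ℝⁿ`

A metric is a map `M : ℝ → Vec n → (Vec n →L[ℝ] Vec n)`; `M t x` is the matrix `M(x,t)`, acting
as a linear operator, so that `inner ℝ v (M t x w)` is `vᵀ M(x,t) w`. -/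

/-- Continuously differentiable curves `c : [0,1] → ℝⁿ` with `c 0 = p` and `c 1 = q`. -/
structure IsCurve {n : ℕ} (c : ℝ → Vec n) (p q : Vec n) : Prop where
  contDiffOn : ContDiffOn ℝ 1 c (Icc 0 1)
  source : c 0 = p
  target : c 1 = q

/-- The velocity `c_s(s)` of a curve on `[0,1]` (one-sided at the two end points). -/
def velocity {n : ℕ} (c : ℝ → Vec n) (s : ℝ) : Vec n :=
  derivWithin c (Icc 0 1) s

/-- Length of a curve, `∫₀¹ √(c_sᵀ M(c,t) c_s) ds`. -/
def curveLength {n : ℕ} (M : ℝ → Vec n → (Vec n →L[ℝ] Vec n)) (t : ℝ) (c : ℝ → Vec n) : ℝ :=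
  ∫ s in (0 : ℝ)..1, √(inner ℝ (velocity c s) (M t (c s) (velocity c s)))

/-- Energy of a curve, `∫₀¹ c_sᵀ M(c,t) c_s ds`. -/
def curveEnergy {n : ℕ} (M : ℝ → Vec n → (Vec n →L[ℝ] Vec n)) (t : ℝ) (c : ℝ → Vec n) : ℝ :=
  ∫ s in (0 : ℝ)..1, inner ℝ (velocity c s) (M t (c s) (velocity c s))

/-- Riemannian distance `d(p,q,t)`: the infimum of the lengths of the curves from `p` to `q`. -/
def riemDist {n : ℕ} (M : ℝ → Vec n → (Vec n →L[ℝ] Vec n)) (t : ℝ) (p q : Vec n) : ℝ :=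
  sInf {l : ℝ | ∃ c : ℝ → Vec n, IsCurve c p q ∧ l = curveLength M t c}

/-- Riemannian energy `E(p,q,t) = d(p,q,t)²`. -/
def riemEnergy {n : ℕ} (M : ℝ → Vec n → (Vec n →L[ℝ] Vec n)) (t : ℝ) (p q : Vec n) : ℝ :=
  riemDist M t p q ^ 2

/-- A minimal geodesic from `p` to `q` for the metric `M(·,t)`: a curve `γ` with
`E(γ,t) = L(γ,t)²` and `L(γ,t) ≤ L(c,t)` for every curve `c` from `p` to `q`. -/
structure IsMinimalGeodesic {n : ℕ} (M : ℝ → Vec n → (Vec n →L[ℝ] Vec n)) (t : ℝ)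
    (γ : ℝ → Vec n) (p q : Vec n) : Prop where
  isCurve : IsCurve γ p q
  energy_eq : curveEnergy M t γ = curveLength M t γ ^ 2
  minimal : ∀ c : ℝ → Vec n, IsCurve c p q → curveLength M t γ ≤ curveLength M t c

/-! ### Control contraction metrics for `ẋ = f(x) + B(x) u`

The columns of `B(x)` are `b i x`, so `B(x) u = ∑ i, u i • b i x`. -/

/-- The vector field of the nominal system, `f(x) + B(x) u`. -/
def nominalField {n m : ℕ} (f : Vec n → Vec n) (b : Fin m → Vec n → Vec n)
    (x : Vec n) (u : Vec m) : Vec n :=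
  f x + ∑ i, u i • b i x

/-- The matrix of the differential dynamics, `A(x,u) = ∂f/∂x + ∑ᵢ uᵢ ∂bᵢ/∂x`. -/
def diffA {n m : ℕ} (f : Vec n → Vec n) (b : Fin m → Vec n → Vec n)
    (x : Vec n) (u : Vec m) : Vec n →L[ℝ] Vec n :=
  fderiv ℝ f x + ∑ i, u i • fderiv ℝ (b i) x

/-- The derivative of the metric along the nominal system,
`Ṁ = ∂M/∂t + ∂_v M` with `v = f(x) + B(x) u`. -/
def metricDot {n m : ℕ} (f : Vec n → Vec n) (b : Fin m → Vec n → Vec n)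
    (M : ℝ → Vec n → (Vec n →L[ℝ] Vec n)) (t : ℝ) (x : Vec n) (u : Vec m) :
    Vec n →L[ℝ] Vec n :=
  deriv (fun τ => M τ x) t + fderiv ℝ (fun y => M t y) x (nominalField f b x u)

/-- The quadratic form `vᵀ (AᵀM + M A + Ṁ) v`. -/
def contractionForm {n m : ℕ} (f : Vec n → Vec n) (b : Fin m → Vec n → Vec n)
    (M : ℝ → Vec n → (Vec n →L[ℝ] Vec n)) (t : ℝ) (x : Vec n) (u : Vec m) (v : Vec n) : ℝ :=
  inner ℝ (diffA f b x u v) (M t x v) + inner ℝ v (M t x (diffA f b x u v))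
    + inner ℝ v (metricDot f b M t x u v)

/-- `M` is a uniformly bounded control contraction metric with rate `lam` for the nominal system:
a continuously differentiable field of symmetric matrices with `α₁ I ≤ M ≤ α₂ I`, `α₁ > 0`, and
`δᵀ M B = 0 → δᵀ (AᵀM + M A + Ṁ + 2 lam M) δ ≤ 0`. -/
structure IsControlContractionMetric {n m : ℕ} (f : Vec n → Vec n) (b : Fin m → Vec n → Vec n)
    (M : ℝ → Vec n → (Vec n →L[ℝ] Vec n)) (lam α₁ α₂ : ℝ) : Prop where
  contDiff : ContDiff ℝ 1 (fun z : ℝ × Vec n => M z.1 z.2)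
  symm : ∀ t, 0 ≤ t → ∀ x v w, inner ℝ v (M t x w) = inner ℝ (M t x v) w
  lower_pos : 0 < α₁
  lower : ∀ t, 0 ≤ t → ∀ x v, α₁ * ‖v‖ ^ 2 ≤ inner ℝ v (M t x v)
  upper : ∀ t, 0 ≤ t → ∀ x v, inner ℝ v (M t x v) ≤ α₂ * ‖v‖ ^ 2
  rate_pos : 0 < lam
  contracting : ∀ t, 0 ≤ t → ∀ x u v, (∀ i, inner ℝ v (M t x (b i x)) = 0) →
    contractionForm f b M t x u v + 2 * lam * inner ℝ v (M t x v) ≤ 0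

/-- `δu` is a differential controller that makes the differential energy `δᵀ M δ` of the nominal
system decrease with rate `2 lam`:
`δᵀ (AᵀM + M A + Ṁ) δ + 2 δᵀ M B δu ≤ -2 lam δᵀ M δ`. The arguments of `δu` are the time, the
state `x`, the displacement `δ`, and the control value `u`. -/
def IsDifferentialController {n m : ℕ} (f : Vec n → Vec n) (b : Fin m → Vec n → Vec n)
    (M : ℝ → Vec n → (Vec n →L[ℝ] Vec n)) (lam : ℝ)
    (δu : ℝ → Vec n → Vec n → Vec m → Vec m) : Prop :=
  ∀ t, 0 ≤ t → ∀ (x v : Vec n) (u : Vec m),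
    contractionForm f b M t x u v + 2 * inner ℝ v (M t x (∑ i, δu t x v u i • b i x))
      ≤ -2 * lam * inner ℝ v (M t x v)

/-- `u` is the value at time `t` of the controller obtained by integrating the differential
controller `δu` along the geodesic `γ` from the desired state `γ 0` (with desired input `ud`) to
the current state `γ 1`: `u = ν 1`, where `ν s = ud + ∫₀ˢ δu(t, γ, γ_s, ν)`. If `δu` does not
depend on its control argument, this is `u = ud + ∫₀¹ δu(t, γ(s), γ_s(s)) ds`. -/
def IsCCMControl {n m : ℕ} (δu : ℝ → Vec n → Vec n → Vec m → Vec m) (t : ℝ) (γ : ℝ → Vec n)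
    (ud u : Vec m) : Prop :=
  ∃ ν : ℝ → Vec m,
    IntervalIntegrable (fun s => δu t (γ s) (velocity γ s) (ν s)) volume 0 1 ∧
    (∀ s ∈ Icc (0 : ℝ) 1, ν s = ud + ∫ r in (0 : ℝ)..s, δu t (γ r) (velocity γ r) (ν r)) ∧
    u = ν 1

/-- The robustified control law
`uᵢ = u_{ccm,i} + φᵢ(x)ᵀ θhat - κ bᵢ(x)ᵀ M(γ(1)) γ_s(1) ‖φᵢ(x)‖²`. -/
def robustControl {n m p : ℕ} (b : Fin m → Vec n → Vec n) (φ : Fin m → Vec n → Vec p)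
    (M : ℝ → Vec n → (Vec n →L[ℝ] Vec n)) (κ : ℝ) (t : ℝ) (x : Vec n) (γ : ℝ → Vec n)
    (uccm : Vec m) (θhat : Vec p) (i : Fin m) : ℝ :=
  uccm i + inner ℝ (φ i x) θhat
    - κ * inner ℝ (b i x) (M t (γ 1) (velocity γ 1)) * ‖φ i x‖ ^ 2

/-! ### Trajectories and Dini derivatives -/

/-- `y` is continuous on `[0,T)` and has right derivative `F t` at each `t ∈ [0,T)`. Classical
solutions of `ẏ = F` qualify; the right-hand side may jump, as a feedback built on a choice of
minimal geodesics can. -/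
def IsTrajectoryOn {n : ℕ} (T : ℝ) (y F : ℝ → Vec n) : Prop :=
  ContinuousOn y (Ico 0 T) ∧ ∀ t ∈ Ico 0 T, HasDerivWithinAt y (F t) (Ici t) t

/-- Upper right Dini derivative `limsup_{h → 0+} (g (t + h) - g t) / h`. -/
def upperRightDini (g : ℝ → ℝ) (t : ℝ) : EReal :=
  limsup (fun h : ℝ => (((g (t + h) - g t) / h : ℝ) : EReal)) (𝓝[>] 0)

end

/-! ### Curves, energy and distance -/

/-! The energy `E(t + h)` is at most the energy of any curve joining the two moved end points.
Deforming the minimal geodesic `γ` at time `t` along a field `w` therefore bounds the upper right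
slope of `E` by the first variation of the energy (`eventually_slope_riemEnergy_lt`). Neither the
geodesic equation nor any regularity of `γ` in `t` is needed.

By matching, the plant is the nominal system under the control `u - φᵀθ`. Take `w = f(γ) + B(γ)μ`
with a control profile `μ` along `γ`. For `μ = ν` the variation integrand is the left side of the
differential controller inequality, so it integrates to at most `-2λE`. But `ν` is only a primitive
of an integrable function, and `ν(1) = u_ccm` is not the control that reaches the plant.
`exists_continuous_rate` makes `μ` a `C¹` profile with the correct end value by concentrating the
correction near `s = 1`. In the limit the mismatch costs only `2 γ_s(1)ᵀ M B (u - φᵀθ - u_ccm)`, and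
`IsCCMControl.exists_variation` assembles this.

In each channel the mismatch is parameter error minus robustifying term; completing the square
bounds its cost by `‖θ⁺ - θ⁻‖² / (2κ)`, whence `K = m/(2κ)`. Continuity of `E`
(`continuousOn_riemEnergy`) and Grönwall give the exponential bound, and `α₁ I ≤ M ≤ α₂ I` transfers
it to the tracking error. -/

theorem sq_integral_le_integral_sq {g : ℝ → ℝ} (hg : ContinuousOn g (Icc 0 1)) :
    (∫ s in (0 : ℝ)..1, g s) ^ 2 ≤ ∫ s in (0 : ℝ)..1, g s ^ 2 := by
  rw [← uIcc_of_le zero_le_one] at hg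
  have h1 : IntervalIntegrable g volume 0 1 := hg.intervalIntegrable
  have h2 : IntervalIntegrable (fun s => g s ^ 2) volume 0 1 := (hg.pow 2).intervalIntegrable
  set a := ∫ s in (0 : ℝ)..1, g s with ha
  -- The variance of `g` about its mean `a` is nonnegative.
  have h0 : 0 ≤ ∫ s in (0 : ℝ)..1, (g s - a) ^ 2 :=
    intervalIntegral.integral_nonneg zero_le_one fun s _ => sq_nonneg _
  have h3 : ∫ s in (0 : ℝ)..1, (g s - a) ^ 2 = (∫ s in (0 : ℝ)..1, g s ^ 2) - a ^ 2 := by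
    have : ∀ s, (g s - a) ^ 2 = g s ^ 2 - 2 * a * g s + a ^ 2 := fun s => by ring
    simp only [this]
    rw [intervalIntegral.integral_add (h2.sub (h1.const_mul _)) (by simp),
      intervalIntegral.integral_sub h2 (h1.const_mul _), intervalIntegral.integral_const_mul, ← ha]
    simp
    ring
  linarith

theorem ContDiffOn.continuousOn_velocity {n : ℕ} {c : ℝ → Vec n}
    (hc : ContDiffOn ℝ 1 c (Icc 0 1)) : ContinuousOn (velocity c) (Icc 0 1) :=
  hc.continuousOn_derivWithin (uniqueDiffOn_Icc zero_lt_one) le_rfl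

theorem ContDiffOn.hasDerivWithinAt_velocity {n : ℕ} {c : ℝ → Vec n}
    (hc : ContDiffOn ℝ 1 c (Icc 0 1)) {s : ℝ} (hs : s ∈ Icc (0 : ℝ) 1) :
    HasDerivWithinAt c (velocity c s) (Icc 0 1) s :=
  (hc.differentiableOn one_ne_zero s hs).hasDerivWithinAt

theorem velocity_eq {n : ℕ} {c : ℝ → Vec n} {v : Vec n} {s : ℝ} (hs : s ∈ Icc (0 : ℝ) 1)
    (hc : HasDerivWithinAt c v (Icc 0 1) s) : velocity c s = v :=
  hc.derivWithin (uniqueDiffOn_Icc zero_lt_one s hs)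

theorem norm_sub_le_integral_norm_velocity {n : ℕ} {c : ℝ → Vec n}
    (hc : ContDiffOn ℝ 1 c (Icc 0 1)) {s : ℝ} (hs : s ∈ Icc (0 : ℝ) 1) :
    ‖c s - c 0‖ ≤ ∫ r in (0 : ℝ)..1, ‖velocity c r‖ := by
  have hv := hc.continuousOn_velocity
  have h1 : ∫ r in (0 : ℝ)..s, velocity c r = c s - c 0 := by
    refine intervalIntegral.integral_eq_sub_of_hasDerivAt_of_le hs.1
      (hc.continuousOn.mono (Icc_subset_Icc_right hs.2)) (fun r hr => ?_) ?_
    · exact (hc.hasDerivWithinAt_velocity ⟨hr.1.le, hr.2.le.trans hs.2⟩).hasDerivAt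
        (Icc_mem_nhds hr.1 (hr.2.trans_le hs.2))
    · refine ContinuousOn.intervalIntegrable ?_
      rw [uIcc_of_le hs.1]
      exact hv.mono (Icc_subset_Icc_right hs.2)
  rw [← h1]
  refine (intervalIntegral.norm_integral_le_integral_norm hs.1).trans ?_
  refine intervalIntegral.integral_mono_interval le_rfl hs.1 hs.2
    (Eventually.of_forall fun _ => norm_nonneg _) ?_
  refine ContinuousOn.intervalIntegrable ?_
  rw [uIcc_of_le zero_le_one]
  exact hv.norm

section Metric

variable {n : ℕ} {M : ℝ → Vec n → (Vec n →L[ℝ] Vec n)}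

theorem continuousOn_metric_velocity (hM : Continuous fun z : ℝ × Vec n => M z.1 z.2) (t : ℝ)
    {c : ℝ → Vec n} (hc : ContDiffOn ℝ 1 c (Icc 0 1)) :
    ContinuousOn (fun s => inner ℝ (velocity c s) (M t (c s) (velocity c s))) (Icc 0 1) := by
  have hv := hc.continuousOn_velocity
  have h : ContinuousOn (fun s => M t (c s)) (Icc 0 1) :=
    (hM.comp (Continuous.prodMk_right t)).comp_continuousOn hc.continuousOn
  exact hv.inner (h.clm_apply hv)

theorem curveLength_nonneg (t : ℝ) (c : ℝ → Vec n) : 0 ≤ curveLength M t c :=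
  intervalIntegral.integral_nonneg zero_le_one fun _ _ => Real.sqrt_nonneg _

theorem curveLength_sq_le_curveEnergy (hM : Continuous fun z : ℝ × Vec n => M z.1 z.2) {t : ℝ}
    (hpos : ∀ x v, 0 ≤ inner ℝ v (M t x v)) {c : ℝ → Vec n} (hc : ContDiffOn ℝ 1 c (Icc 0 1)) :
    curveLength M t c ^ 2 ≤ curveEnergy M t c := by
  have h := sq_integral_le_integral_sq (continuousOn_metric_velocity hM t hc).sqrt
  simpa only [Real.sq_sqrt (hpos _ _), curveLength, curveEnergy] using h

theorem riemDist_nonneg (t : ℝ) (p q : Vec n) : 0 ≤ riemDist M t p q := by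
  refine Real.sInf_nonneg ?_
  rintro _ ⟨c, -, rfl⟩
  exact curveLength_nonneg t c

theorem riemDist_le_curveLength (t : ℝ) {c : ℝ → Vec n} {p q : Vec n} (hc : IsCurve c p q) :
    riemDist M t p q ≤ curveLength M t c := by
  refine csInf_le ⟨0, ?_⟩ ⟨c, hc, rfl⟩
  rintro _ ⟨c, -, rfl⟩
  exact curveLength_nonneg t c

theorem riemEnergy_le_curveEnergy (hM : Continuous fun z : ℝ × Vec n => M z.1 z.2) {t : ℝ}
    (hpos : ∀ x v, 0 ≤ inner ℝ v (M t x v)) {c : ℝ → Vec n} {p q : Vec n} (hc : IsCurve c p q) :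
    riemEnergy M t p q ≤ curveEnergy M t c :=
  (pow_le_pow_left₀ (riemDist_nonneg t p q) (riemDist_le_curveLength t hc) 2).trans
    (curveLength_sq_le_curveEnergy hM hpos hc.contDiffOn)

theorem IsMinimalGeodesic.riemEnergy_eq {t : ℝ} {c : ℝ → Vec n} {p q : Vec n}
    (hc : IsMinimalGeodesic M t c p q) : riemEnergy M t p q = curveEnergy M t c := by
  have h : riemDist M t p q = curveLength M t c := by
    refine le_antisymm (riemDist_le_curveLength t hc.isCurve)
      (le_csInf ⟨_, c, hc.isCurve, rfl⟩ ?_)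
    rintro _ ⟨c', hc', rfl⟩
    exact hc.minimal c' hc'
  rw [riemEnergy, h, hc.energy_eq]

theorem isCurve_segment (p q : Vec n) : IsCurve (fun s : ℝ => p + s • (q - p)) p q where
  contDiffOn := by fun_prop
  source := by simp
  target := by simp

theorem velocity_segment (p q : Vec n) {s : ℝ} (hs : s ∈ Icc (0 : ℝ) 1) :
    velocity (fun s : ℝ => p + s • (q - p)) s = q - p := by
  refine velocity_eq hs (HasDerivAt.hasDerivWithinAt ?_)
  simpa using ((hasDerivAt_id s).smul_const (q - p)).const_add p

/-- The straight segment is a competitor, and its velocity is constant. -/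
theorem riemEnergy_le_mul_norm_sq (hM : Continuous fun z : ℝ × Vec n => M z.1 z.2) {t a : ℝ}
    (hpos : ∀ x v, 0 ≤ inner ℝ v (M t x v)) (ha : ∀ x v, inner ℝ v (M t x v) ≤ a * ‖v‖ ^ 2)
    (p q : Vec n) : riemEnergy M t p q ≤ a * ‖q - p‖ ^ 2 := by
  have hc := isCurve_segment p q
  refine (riemEnergy_le_curveEnergy hM hpos hc).trans ?_
  have hcont := continuousOn_metric_velocity hM t hc.contDiffOn
  rw [← uIcc_of_le zero_le_one] at hcont
  have := intervalIntegral.integral_mono_on (μ := volume) (g := fun _ => a * ‖q - p‖ ^ 2)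
    zero_le_one hcont.intervalIntegrable intervalIntegrable_const fun s hs => (ha _ _).trans_eq (by
      rw [velocity_segment p q hs])
  simpa [curveEnergy] using this

theorem mul_integral_norm_velocity_sq_le (hM : Continuous fun z : ℝ × Vec n => M z.1 z.2)
    {t a : ℝ} (ha : ∀ x v, a * ‖v‖ ^ 2 ≤ inner ℝ v (M t x v)) {c : ℝ → Vec n}
    (hc : ContDiffOn ℝ 1 c (Icc 0 1)) :
    a * ∫ s in (0 : ℝ)..1, ‖velocity c s‖ ^ 2 ≤ curveEnergy M t c := by
  have hcont := continuousOn_metric_velocity hM t hc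
  have hv := hc.continuousOn_velocity
  rw [← uIcc_of_le zero_le_one] at hcont hv
  rw [← intervalIntegral.integral_const_mul]
  exact intervalIntegral.integral_mono_on zero_le_one
    ((hv.norm.pow 2).intervalIntegrable.const_mul _) hcont.intervalIntegrable
    fun s _ => ha _ _

theorem mul_norm_sq_le_curveEnergy (hM : Continuous fun z : ℝ × Vec n => M z.1 z.2)
    {t a : ℝ} (ha0 : 0 ≤ a) (ha : ∀ x v, a * ‖v‖ ^ 2 ≤ inner ℝ v (M t x v)) {c : ℝ → Vec n}
    {p q : Vec n} (hc : IsCurve c p q) : a * ‖q - p‖ ^ 2 ≤ curveEnergy M t c := by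
  refine le_trans (mul_le_mul_of_nonneg_left ?_ ha0)
    (mul_integral_norm_velocity_sq_le hM ha hc.contDiffOn)
  have h1 := norm_sub_le_integral_norm_velocity hc.contDiffOn (right_mem_Icc.2 zero_le_one)
  rw [hc.source, hc.target] at h1
  exact (pow_le_pow_left₀ (norm_nonneg _) h1 2).trans
    (sq_integral_le_integral_sq hc.contDiffOn.continuousOn_velocity.norm)

end Metric

/-! ### First variation of the energy -/

/-- Dominated convergence. The direction `ζ h` may vary with `h`, because the end points of the
curves move only to first order along a fixed direction. -/
theorem tendsto_slope_integral_of_contDiff {F : Type*} [NormedAddCommGroup F] [NormedSpace ℝ F]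
    [ProperSpace F] {G : F → ℝ} (hG : ContDiff ℝ 1 G) {z : ℝ → F}
    (hz : ContinuousOn z (Icc 0 1)) {ζ : ℝ → ℝ → F} {ζ₀ : ℝ → F} {C : ℝ}
    (hζ : ∀ h, ContinuousOn (ζ h) (Icc 0 1))
    (hC : ∀ᶠ h in 𝓝[>] (0 : ℝ), ∀ s ∈ Icc (0 : ℝ) 1, ‖ζ h s‖ ≤ C)
    (hlim : ∀ s ∈ Icc (0 : ℝ) 1, Tendsto (fun h => ζ h s) (𝓝[>] 0) (𝓝 (ζ₀ s))) :
    Tendsto (fun h : ℝ => h⁻¹ * ((∫ s in (0 : ℝ)..1, G (z s + h • ζ h s))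
      - ∫ s in (0 : ℝ)..1, G (z s))) (𝓝[>] 0)
      (𝓝 (∫ s in (0 : ℝ)..1, fderiv ℝ G (z s) (ζ₀ s))) := by
  obtain ⟨R, hR⟩ := isCompact_Icc.exists_bound_of_continuousOn hz
  -- For `0 < h < 1` all perturbed points stay in this ball, so a single Lipschitz constant gives
  -- the dominating bound `L * C`.
  obtain ⟨L, hL⟩ := hG.contDiffOn.exists_lipschitzOnWith one_ne_zero
    (convex_closedBall (0 : F) (R + C)) (isCompact_closedBall _ _)
  have hh1 : ∀ᶠ h in 𝓝[>] (0 : ℝ), h < 1 := mem_nhdsWithin_of_mem_nhds (Iio_mem_nhds one_pos)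
  have hh0 : ∀ᶠ h in 𝓝[>] (0 : ℝ), 0 < h := self_mem_nhdsWithin
  have hGz : IntervalIntegrable (fun s => G (z s)) volume 0 1 :=
    ContinuousOn.intervalIntegrable (by
      rw [uIcc_of_le zero_le_one]; exact hG.continuous.comp_continuousOn hz)
  have hGh : ∀ h, ContinuousOn (fun s => G (z s + h • ζ h s)) (Icc 0 1) := fun h =>
    hG.continuous.comp_continuousOn (hz.add ((hζ h).const_smul h))
  have key : Tendsto (fun h : ℝ => ∫ s in (0 : ℝ)..1, h⁻¹ * (G (z s + h • ζ h s) - G (z s)))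
      (𝓝[>] 0) (𝓝 (∫ s in (0 : ℝ)..1, fderiv ℝ G (z s) (ζ₀ s))) := by
    refine intervalIntegral.tendsto_integral_filter_of_dominated_convergence (fun _ => L * C)
      (Eventually.of_forall fun h => ?_) ?_ (by simp) (Eventually.of_forall fun s hs => ?_)
    · refine ContinuousOn.aestronglyMeasurable ?_ measurableSet_uIoc
      rw [uIoc_of_le zero_le_one]
      exact (((hGh h).sub (hG.continuous.comp_continuousOn hz)).const_mul _).mono
        Ioc_subset_Icc_self
    · filter_upwards [hC, hh0, hh1] with h hC h0 h1
      refine Eventually.of_forall fun s hs => ?_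
      rw [uIoc_of_le zero_le_one] at hs
      replace hs := Ioc_subset_Icc_self hs
      have hC0 : 0 ≤ C := (norm_nonneg _).trans (hC s hs)
      have e1 : ‖h • ζ h s‖ ≤ h * C := by
        rw [norm_smul, Real.norm_of_nonneg h0.le]
        exact mul_le_mul_of_nonneg_left (hC s hs) h0.le
      have e2 := hL.norm_sub_le (x := z s + h • ζ h s) (y := z s)
        (by
          rw [mem_closedBall_zero_iff]
          refine (norm_add_le _ _).trans (add_le_add (hR s hs) (e1.trans ?_))
          exact mul_le_of_le_one_left hC0 h1.le)
        (by
          rw [mem_closedBall_zero_iff]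
          linarith [hR s hs])
      rw [add_sub_cancel_left] at e2
      rw [norm_mul, norm_inv, Real.norm_of_nonneg h0.le, inv_mul_le_iff₀ h0]
      calc _ ≤ L * ‖h • ζ h s‖ := e2
        _ ≤ L * (h * C) := by gcongr
        _ = _ := by ring
    · rw [uIoc_of_le zero_le_one] at hs
      have hs' := hlim s (Ioc_subset_Icc_self hs)
      have hd : HasFDerivWithinAt G (fderiv ℝ G (z s)) univ (z s) :=
        (hG.differentiable one_ne_zero (z s)).hasFDerivAt.hasFDerivWithinAt
      have h0 : Tendsto (fun h : ℝ => h) (𝓝[>] 0) (𝓝 0) := tendsto_id.mono_left nhdsWithin_le_nhds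
      have := hd.lim (c := fun h : ℝ => h⁻¹) (d := fun h => h • ζ h s) (v := ζ₀ s) (l := 𝓝[>] 0)
        (by simpa using h0.smul hs') (by simp)
        (hs'.congr' (by
          filter_upwards [hh0] with h h0
          rw [inv_smul_smul₀ h0.ne']))
      simpa using this
  refine key.congr fun h => ?_
  rw [intervalIntegral.integral_const_mul, intervalIntegral.integral_sub _ hGz]
  refine ContinuousOn.intervalIntegrable ?_
  rw [uIcc_of_le zero_le_one]
  exact hGh h

theorem HasDerivWithinAt.tendsto_slope_right_sub {F : Type*} [NormedAddCommGroup F]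
    [NormedSpace ℝ F] {y : ℝ → F} {v : F} {t : ℝ} (hy : HasDerivWithinAt y v (Ici t) t) :
    Tendsto (fun h : ℝ => h⁻¹ • (y (t + h) - y t)) (𝓝[>] 0) (𝓝 v) := by
  have h1 := (hasDerivWithinAt_iff_tendsto_slope' self_notMem_Ioi).1 hy.Ioi_of_Ici
  have h2 : Tendsto (fun h : ℝ => t + h) (𝓝[>] 0) (𝓝[>] t) := by
    refine tendsto_nhdsWithin_iff.2 ⟨?_, ?_⟩
    · refine Tendsto.mono_left ?_ nhdsWithin_le_nhds
      have hc : Continuous fun h : ℝ => t + h := by fun_prop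
      simpa using hc.tendsto 0
    · filter_upwards [self_mem_nhdsWithin] with h hh
      simpa using hh
  refine (h1.comp h2).congr fun h => ?_
  simp [slope_def_module]

section Variation

variable {n : ℕ} {M : ℝ → Vec n → (Vec n →L[ℝ] Vec n)}

/-- The quadratic form `vᵀ M(x,t) v` as a function of `(t, x, v)`. -/
noncomputable def metricForm (M : ℝ → Vec n → (Vec n →L[ℝ] Vec n)) (z : ℝ × Vec n × Vec n) : ℝ :=
  inner ℝ z.2.2 (M z.1 z.2.1 z.2.2)

theorem contDiff_metricForm (hM : ContDiff ℝ 1 fun z : ℝ × Vec n => M z.1 z.2) :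
    ContDiff ℝ 1 (metricForm M) := by
  have h1 : ContDiff ℝ 1 fun z : ℝ × Vec n × Vec n => M z.1 z.2.1 :=
    hM.comp (contDiff_fst.prodMk (contDiff_fst.comp contDiff_snd))
  have h2 : ContDiff ℝ 1 fun z : ℝ × Vec n × Vec n => z.2.2 := contDiff_snd.comp contDiff_snd
  exact h2.inner ℝ (h1.clm_apply h2)

/-- Differentiate along the line `h ↦ (t + h, x + h w, v + h u)` by the chain rule and by the
product rule, and compare. Joint differentiability of `M` lets the time and space derivatives add up
to one directional derivative. -/
theorem fderiv_metricForm (hM : ContDiff ℝ 1 fun z : ℝ × Vec n => M z.1 z.2) (t : ℝ)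
    (x v w u : Vec n) :
    fderiv ℝ (metricForm M) (t, x, v) (1, w, u) = inner ℝ u (M t x v) + inner ℝ v (M t x u)
      + inner ℝ v ((deriv (fun τ => M τ x) t + fderiv ℝ (fun y => M t y) x w) v) := by
  have hd := (hM.differentiable one_ne_zero (t, x)).hasFDerivAt
  set D := fderiv ℝ (fun z : ℝ × Vec n => M z.1 z.2) (t, x) with hD
  have ht : deriv (fun τ => M τ x) t = D (1, 0) :=
    (HasFDerivAt.comp_hasDerivAt (l := fun z : ℝ × Vec n => M z.1 z.2) (f := fun τ => (τ, x)) t hd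
      ((hasDerivAt_id t).prodMk (hasDerivAt_const t x))).deriv
  have hx : fderiv ℝ (fun y => M t y) x w = D (0, w) := by
    have := (hd.comp x ((hasFDerivAt_const t x).prodMk (hasFDerivAt_id x))).fderiv
    have h2 := congrArg (fun A : Vec n →L[ℝ] (Vec n →L[ℝ] Vec n) => A w) this
    simpa [Function.comp_def] using h2
  have hsum : deriv (fun τ => M τ x) t + fderiv ℝ (fun y => M t y) x w = D (1, w) := by
    rw [ht, hx, ← map_add]
    simp
  have hl : HasDerivAt (fun h : ℝ => (t + h, x + h • w, v + h • u)) (1, w, u) 0 := by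
    refine HasDerivAt.prodMk ?_ (HasDerivAt.prodMk ?_ ?_)
    · simpa using (hasDerivAt_id (0 : ℝ)).const_add t
    · simpa using ((hasDerivAt_id (0 : ℝ)).smul_const w).const_add x
    · simpa using ((hasDerivAt_id (0 : ℝ)).smul_const u).const_add v
  have hlM : HasDerivAt (fun h : ℝ => M (t + h) (x + h • w)) (D (1, w)) 0 := by
    refine HasFDerivAt.comp_hasDerivAt (l := fun z : ℝ × Vec n => M z.1 z.2)
      (f := fun h : ℝ => (t + h, x + h • w)) (0 : ℝ) (by simpa using hd) ?_
    exact HasDerivAt.prodMk hl.fst hl.snd.fst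
  have hv : HasDerivAt (fun h : ℝ => v + h • u) u 0 := hl.snd.snd
  have e1 := hv.inner ℝ (hlM.clm_apply hv)
  have e2 : HasDerivAt (fun h : ℝ => metricForm M (t + h, x + h • w, v + h • u))
      (fderiv ℝ (metricForm M) (t, x, v) (1, w, u)) 0 := by
    refine HasFDerivAt.comp_hasDerivAt (l := metricForm M)
      (f := fun h : ℝ => (t + h, x + h • w, v + h • u)) (0 : ℝ) ?_ hl
    simpa using ((contDiff_metricForm hM).differentiable one_ne_zero (t, x, v)).hasFDerivAt
  rw [e2.unique e1, hsum]
  simp [inner_add_right]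
  ring

/-- First variation: the energy between two moving points grows no faster than the energy of any
`C¹` variation of a minimal geodesic that follows the two points to first order. -/
theorem eventually_slope_riemEnergy_lt (hM : ContDiff ℝ 1 fun z : ℝ × Vec n => M z.1 z.2)
    (hpos : ∀ t, 0 ≤ t → ∀ x v, 0 ≤ inner ℝ v (M t x v)) {t : ℝ} (ht : 0 ≤ t)
    {p q : ℝ → Vec n} {p' q' : Vec n} (hp : HasDerivWithinAt p p' (Ici t) t)
    (hq : HasDerivWithinAt q q' (Ici t) t) {γ : ℝ → Vec n}
    (hγ : IsMinimalGeodesic M t γ (p t) (q t)) {w : ℝ → Vec n} (hw : IsCurve w p' q') {r : ℝ}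
    (hr : ∫ s in (0 : ℝ)..1, fderiv ℝ (metricForm M) (t, γ s, velocity γ s)
      (1, w s, velocity w s) < r) :
    ∀ᶠ h in 𝓝[>] (0 : ℝ),
      h⁻¹ * (riemEnergy M (t + h) (p (t + h)) (q (t + h)) - riemEnergy M t (p t) (q t)) < r := by
  set P : ℝ → Vec n := fun h => h⁻¹ • (p (t + h) - p t) - p' with hP
  set Q : ℝ → Vec n := fun h => h⁻¹ • (q (t + h) - q t) - q' with hQ
  have hP0 : Tendsto P (𝓝[>] 0) (𝓝 0) := by
    simpa using hp.tendsto_slope_right_sub.sub_const p'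
  have hQ0 : Tendsto Q (𝓝[>] 0) (𝓝 0) := by
    simpa using hq.tendsto_slope_right_sub.sub_const q'
  have hγ1 := hγ.isCurve.contDiffOn
  have hw1 := hw.contDiffOn
  -- `w` matches the end velocities only to first order. Interpolating the remainders `P h`, `Q h`
  -- affinely in `s` makes the competitor end exactly at `p (t + h)` and `q (t + h)`; this
  -- correction has norm at most 2 once both remainders are below 1.
  set ζ : ℝ → ℝ → ℝ × Vec n × Vec n := fun h s =>
    (1, w s, velocity w s) + (0, (1 - s) • P h + s • Q h, Q h - P h) with hζ
  have hwc : ContinuousOn (fun s => ((1 : ℝ), w s, velocity w s)) (Icc 0 1) :=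
    continuousOn_const.prodMk (hw1.continuousOn.prodMk hw1.continuousOn_velocity)
  obtain ⟨C, hC⟩ := isCompact_Icc.exists_bound_of_continuousOn hwc
  have key := tendsto_slope_integral_of_contDiff (contDiff_metricForm hM)
    (z := fun s => (t, γ s, velocity γ s)) (ζ := ζ) (ζ₀ := fun s => (1, w s, velocity w s))
    (C := C + 2)
    (continuousOn_const.prodMk (hγ1.continuousOn.prodMk hγ1.continuousOn_velocity))
    (fun h => hwc.add (by fun_prop))
    (by
      filter_upwards [hP0.norm.eventually_lt_const (u := 1) (by simp),
        hQ0.norm.eventually_lt_const (u := 1) (by simp)] with h h1 h2 s hs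
      refine (norm_add_le _ _).trans (add_le_add (hC s hs) ?_)
      rw [Prod.norm_mk, Prod.norm_mk]
      refine max_le (by simp) (max_le ?_ ?_)
      · refine (norm_add_le _ _).trans ?_
        rw [norm_smul, norm_smul, Real.norm_of_nonneg hs.1,
          Real.norm_of_nonneg (sub_nonneg.2 hs.2)]
        nlinarith [hs.1, hs.2]
      · refine (norm_sub_le _ _).trans ?_
        linarith)
    (fun s _ => by
      have h1 : Tendsto (fun h => ((0 : ℝ), (1 - s) • P h + s • Q h, Q h - P h)) (𝓝[>] 0)
          (𝓝 (0, (1 - s) • 0 + s • 0, 0 - 0)) :=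
        tendsto_const_nhds.prodMk_nhds
          (((hP0.const_smul _).add (hQ0.const_smul _)).prodMk_nhds (hQ0.sub hP0))
      simpa [hζ, ← Prod.zero_eq_mk] using h1.const_add (1, w s, velocity w s))
  filter_upwards [key.eventually_lt_const hr, self_mem_nhdsWithin] with h hlt h0
  have h0 : 0 < h := h0
  -- Minimality is used only at time `t`; at `t + h` any competitor bounds the energy from above.
  refine lt_of_le_of_lt (mul_le_mul_of_nonneg_left ?_ (inv_nonneg.2 h0.le)) hlt
  rw [hγ.riemEnergy_eq]
  refine sub_le_sub_right ?_ _
  set c : ℝ → Vec n := fun s => γ s + h • (w s + ((1 - s) • P h + s • Q h)) with hc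
  have hPh : h • (p' + P h) = p (t + h) - p t := by simp [hP, smul_inv_smul₀ h0.ne']
  have hQh : h • (q' + Q h) = q (t + h) - q t := by simp [hQ, smul_inv_smul₀ h0.ne']
  have hcurve : IsCurve c (p (t + h)) (q (t + h)) := by
    refine ⟨?_, ?_, ?_⟩
    · exact hγ1.add ((hw1.add (by fun_prop)).const_smul h)
    · simp only [hc, hγ.isCurve.source, hw.source, sub_zero, one_smul, zero_smul, add_zero, hPh,
        add_sub_cancel]
    · simp only [hc, hγ.isCurve.target, hw.target, sub_self, one_smul, zero_smul, zero_add, hQh,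
        add_sub_cancel]
  have hvel : ∀ s ∈ Icc (0 : ℝ) 1,
      velocity c s = velocity γ s + h • (velocity w s + (Q h - P h)) := fun s hs => by
    refine velocity_eq hs ?_
    refine (hγ1.hasDerivWithinAt_velocity hs).add
      (((hw1.hasDerivWithinAt_velocity hs).add (HasDerivAt.hasDerivWithinAt ?_)).const_smul h)
    have e1 := (((hasDerivAt_id s).const_sub 1).smul_const (P h)).add
      ((hasDerivAt_id s).smul_const (Q h))
    refine e1.congr_deriv ?_
    simp
    abel
  refine (riemEnergy_le_curveEnergy hM.continuous (hpos _ (by positivity)) hcurve).trans_eq ?_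
  refine intervalIntegral.integral_congr fun s hs => ?_
  rw [uIcc_of_le zero_le_one] at hs
  simp only [metricForm, hζ, hvel s hs]
  simp [hc]

end Variation

/-! ### Continuity of the energy between two moving points -/

/-- The error grows at most quadratically in `v`, so along a curve it is controlled by the `L²` norm
of the velocity alone; no uniform bound on the velocity is needed. -/
theorem inner_add_apply_add_le {V : Type*} [NormedAddCommGroup V] [InnerProductSpace ℝ V]
    {A A₀ : V →L[ℝ] V} {C η : ℝ} (hA : ‖A‖ ≤ C) (hη : η ≤ 1) (hAA : ‖A - A₀‖ ≤ η) {u v : V}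
    (hu : ‖u‖ ≤ η) :
    inner ℝ (v + u) (A (v + u)) ≤ inner ℝ v (A₀ v) + η * (2 * C + (C + 1) * ‖v‖ ^ 2) := by
  have hb : ∀ (B : V →L[ℝ] V) {c : ℝ}, ‖B‖ ≤ c → ∀ x y, inner ℝ x (B y) ≤ c * (‖x‖ * ‖y‖) := by
    intro B c hB x y
    calc inner ℝ x (B y) ≤ ‖x‖ * ‖B y‖ := real_inner_le_norm _ _
      _ ≤ ‖x‖ * (c * ‖y‖) := by gcongr; exact B.le_of_opNorm_le hB y
      _ = _ := by ring
  have hη0 : 0 ≤ η := (norm_nonneg _).trans hu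
  have hC0 : 0 ≤ C := (norm_nonneg _).trans hA
  have e : inner ℝ (v + u) (A (v + u)) = inner ℝ v (A₀ v) + inner ℝ v ((A - A₀) v)
      + inner ℝ u (A v) + inner ℝ v (A u) + inner ℝ u (A u) := by
    simp only [map_add, inner_add_left, inner_add_right, sub_apply,
      inner_sub_right]
    ring
  have h1 := hb _ hAA v v
  have h2 := hb A hA u v
  have h3 := hb A hA v u
  have h4 := hb A hA u u
  have h5 : C * (‖u‖ * ‖v‖) ≤ C * (η * ‖v‖) := by gcongr
  have h6 : C * (‖u‖ * ‖u‖) ≤ C * (η * 1) := by gcongr; exact hu.trans hη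
  -- Absorbs the two cross terms through `2‖v‖ ≤ 1 + ‖v‖²`.
  have h7 : 0 ≤ C * η * (‖v‖ - 1) ^ 2 := by positivity
  rw [e]
  nlinarith

/-- The chosen geodesics may jump with `t`, so they are never compared with each other. Instead the
geodesic at `t` is shifted affinely into a competitor at `t'`, which bounds `E(t')` by `E(t) + ε`.
The step size is uniform in `t`, since all geodesics lie in one ball with one `L²` velocity bound,
so the roles of `t` and `t'` can be exchanged. -/
theorem continuousOn_riemEnergy {n : ℕ} {M : ℝ → Vec n → (Vec n →L[ℝ] Vec n)}
    (hM : Continuous fun z : ℝ × Vec n => M z.1 z.2) {a₁ a₂ : ℝ} (ha₁ : 0 < a₁)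
    (hlow : ∀ t, 0 ≤ t → ∀ x v, a₁ * ‖v‖ ^ 2 ≤ inner ℝ v (M t x v))
    (hup : ∀ t, 0 ≤ t → ∀ x v, inner ℝ v (M t x v) ≤ a₂ * ‖v‖ ^ 2) {T : ℝ} {p q : ℝ → Vec n}
    (hp : ContinuousOn p (Icc 0 T)) (hq : ContinuousOn q (Icc 0 T)) {γ : ℝ → ℝ → Vec n}
    (hγ : ∀ t ∈ Icc 0 T, IsMinimalGeodesic M t (γ t) (p t) (q t)) :
    ContinuousOn (fun t => riemEnergy M t (p t) (q t)) (Icc 0 T) := by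
  have hpos : ∀ t, 0 ≤ t → ∀ x v, 0 ≤ inner ℝ v (M t x v) := fun t ht x v =>
    (by positivity : 0 ≤ a₁ * ‖v‖ ^ 2).trans (hlow t ht x v)
  obtain ⟨D, hD⟩ := isCompact_Icc.exists_bound_of_continuousOn (hq.sub hp)
  obtain ⟨D', hD'⟩ := isCompact_Icc.exists_bound_of_continuousOn hp
  -- From `a₁ ∫‖γ_s‖² ≤ E ≤ a₂ ‖q - p‖²`.
  set S : ℝ := |a₂| * D ^ 2 / a₁ with hS
  have hS0 : 0 ≤ S := by positivity
  have hSb : ∀ t ∈ Icc 0 T, ∫ s in (0 : ℝ)..1, ‖velocity (γ t) s‖ ^ 2 ≤ S := by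
    intro t ht
    rw [hS, le_div_iff₀' ha₁]
    refine (mul_integral_norm_velocity_sq_le hM (hlow t ht.1) (hγ t ht).isCurve.contDiffOn).trans ?_
    rw [← (hγ t ht).riemEnergy_eq]
    refine (riemEnergy_le_mul_norm_sq hM (hpos t ht.1) (hup t ht.1) _ _).trans ?_
    gcongr
    · exact le_abs_self _
    · exact hD t ht
  have hball : ∀ t ∈ Icc 0 T, ∀ s ∈ Icc (0 : ℝ) 1, ‖γ t s‖ ≤ D' + (1 + S) := by
    intro t ht s hs
    have hc := (hγ t ht).isCurve
    have h1 := norm_sub_le_integral_norm_velocity hc.contDiffOn hs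
    have h2 := sq_integral_le_integral_sq hc.contDiffOn.continuousOn_velocity.norm
    have h3 := hSb t ht
    rw [hc.source] at h1
    have h4 := hD' t ht
    have h5 := norm_le_norm_add_norm_sub (p t) (γ t s)
    rw [norm_sub_rev] at h5
    nlinarith
  have hK : IsCompact (Icc 0 T ×ˢ Metric.closedBall (0 : Vec n) (D' + (1 + S) + 1)) :=
    isCompact_Icc.prod (isCompact_closedBall _ _)
  have hMuc := Metric.uniformContinuousOn_iff.1
    (hK.uniformContinuousOn_of_continuous hM.continuousOn)
  have hpuc := Metric.uniformContinuousOn_iff.1 (isCompact_Icc.uniformContinuousOn_of_continuous hp)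
  have hquc := Metric.uniformContinuousOn_iff.1 (isCompact_Icc.uniformContinuousOn_of_continuous hq)
  obtain ⟨C, hC⟩ := hK.exists_bound_of_continuousOn hM.continuousOn
  have key : ∀ ε > 0, ∃ δ > 0, ∀ t ∈ Icc 0 T, ∀ t' ∈ Icc 0 T, dist t' t < δ →
      riemEnergy M t' (p t') (q t') ≤ riemEnergy M t (p t) (q t) + ε := by
    intro ε hε
    -- Bounds the integral of the error factor in `inner_add_apply_add_le`; the final 1 only makes
    -- `B` positive.
    set B : ℝ := 2 * |C| + (|C| + 1) * S + 1 with hB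
    have hB0 : 0 < B := by positivity
    set η : ℝ := min 1 (ε / B) with hη
    have hη0 : 0 < η := by positivity
    obtain ⟨δ₁, hδ₁, h₁⟩ := hMuc η hη0
    -- The velocity changes by a difference of two end point shifts, hence the half.
    set ρ : ℝ := min δ₁ (η / 2) with hρ
    have hρ0 : 0 < ρ := by positivity
    obtain ⟨δ₂, hδ₂, h₂⟩ := hpuc ρ hρ0
    obtain ⟨δ₃, hδ₃, h₃⟩ := hquc ρ hρ0
    refine ⟨min δ₁ (min δ₂ δ₃), by positivity, fun t ht t' ht' hd => ?_⟩
    have hP := h₂ t' ht' t ht (hd.trans_le ((min_le_right _ _).trans (min_le_left _ _)))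
    have hQ := h₃ t' ht' t ht (hd.trans_le ((min_le_right _ _).trans (min_le_right _ _)))
    rw [dist_eq_norm] at hP hQ
    have hc := (hγ t ht).isCurve
    have hc1 := hc.contDiffOn
    set e : ℝ → Vec n := fun s => (1 - s) • (p t' - p t) + s • (q t' - q t) with he
    have hele : ∀ s ∈ Icc (0 : ℝ) 1, ‖e s‖ < ρ := by
      intro s hs
      refine (norm_add_le _ _).trans_lt ?_
      rw [norm_smul, norm_smul, Real.norm_of_nonneg hs.1, Real.norm_of_nonneg (sub_nonneg.2 hs.2)]
      rcases hs.1.eq_or_lt with h | h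
      · simpa [← h] using hP
      · nlinarith [hs.2]
    have hcurve : IsCurve (fun s => γ t s + e s) (p t') (q t') := by
      refine ⟨hc1.add (by fun_prop), ?_, ?_⟩
      · simp [he, hc.source]
      · simp [he, hc.target]
    have hvel : ∀ s ∈ Icc (0 : ℝ) 1, velocity (fun s => γ t s + e s) s
        = velocity (γ t) s + ((q t' - q t) - (p t' - p t)) := fun s hs => by
      refine velocity_eq hs
        ((hc1.hasDerivWithinAt_velocity hs).add (HasDerivAt.hasDerivWithinAt ?_))
      have e1 := (((hasDerivAt_id s).const_sub 1).smul_const (p t' - p t)).add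
        ((hasDerivAt_id s).smul_const (q t' - q t))
      refine e1.congr_deriv ?_
      simp
      abel
    have hcont := continuousOn_metric_velocity hM t' hcurve.contDiffOn
    have hcont' := continuousOn_metric_velocity hM t hc1
    have hcont'' : ContinuousOn (fun s => ‖velocity (γ t) s‖ ^ 2) (Icc 0 1) :=
      hc1.continuousOn_velocity.norm.pow 2
    rw [← uIcc_of_le zero_le_one] at hcont hcont' hcont''
    have hI := hcont''.intervalIntegrable (μ := volume)
    have hmono := intervalIntegral.integral_mono_on (μ := volume)
      (g := fun s => inner ℝ (velocity (γ t) s) (M t (γ t s) (velocity (γ t) s))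
        + η * (2 * |C| + (|C| + 1) * ‖velocity (γ t) s‖ ^ 2)) zero_le_one
      hcont.intervalIntegrable
      (hcont'.intervalIntegrable.add
        ((intervalIntegrable_const.add (hI.const_mul _)).const_mul _)) fun s hs => by
        have hm1 : (t, γ t s) ∈ Icc 0 T ×ˢ Metric.closedBall (0 : Vec n) (D' + (1 + S) + 1) :=
          ⟨ht, mem_closedBall_zero_iff.2 ((hball t ht s hs).trans (by linarith))⟩
        have hm2 : (t', γ t s + e s) ∈
            Icc 0 T ×ˢ Metric.closedBall (0 : Vec n) (D' + (1 + S) + 1) := by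
          refine ⟨ht', mem_closedBall_zero_iff.2 ((norm_add_le _ _).trans
            (add_le_add (hball t ht s hs) ((hele s hs).le.trans ?_)))⟩
          exact (min_le_right _ _).trans (by linarith [min_le_left 1 (ε / B)])
        rw [hvel s hs]
        refine inner_add_apply_add_le ((hC _ hm2).trans (le_abs_self C)) (min_le_left _ _) ?_ ?_
        · rw [← dist_eq_norm]
          refine (h₁ _ hm2 _ hm1 ?_).le
          rw [Prod.dist_eq]
          refine max_lt (hd.trans_le (min_le_left _ _)) ?_
          rw [dist_eq_norm, add_sub_cancel_left]
          exact (hele s hs).trans_le (min_le_left _ _)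
        · refine (norm_sub_le _ _).trans ?_
          linarith [min_le_right δ₁ (η / 2)]
    rw [intervalIntegral.integral_add hcont'.intervalIntegrable
      ((intervalIntegrable_const.add (hI.const_mul _)).const_mul _),
      intervalIntegral.integral_const_mul,
      intervalIntegral.integral_add intervalIntegrable_const (hI.const_mul _)] at hmono
    refine (riemEnergy_le_curveEnergy hM (hpos _ ht'.1) hcurve).trans ?_
    rw [(hγ t ht).riemEnergy_eq]
    refine hmono.trans (add_le_add_right ?_ _)
    simp only [intervalIntegral.integral_const, sub_zero, one_smul]
    calc _ ≤ η * B := by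
          gcongr
          rw [hB, intervalIntegral.integral_const_mul]
          have := mul_le_mul_of_nonneg_left (hSb t ht) (by positivity : 0 ≤ |C| + 1)
          linarith
      _ ≤ ε / B * B := by gcongr; exact min_le_right _ _
      _ = ε := by field_simp
  refine Metric.continuousOn_iff.2 fun t ht ε hε => ?_
  obtain ⟨δ, hδ, h⟩ := key (ε / 2) (by positivity)
  refine ⟨δ, hδ, fun t' ht' hd => ?_⟩
  have h1 := h t ht t' ht' hd
  have h2 := h t' ht' t ht (by rwa [dist_comm])
  rw [Real.dist_eq, abs_lt]
  constructor <;> linarith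

/-! ### Approximation of an integrable control rate with a prescribed end value -/

/-- The probability densities `(n + 1) sⁿ` on `[0,1]` concentrate at `s = 1`. -/
theorem tendsto_mul_integral_pow_mul {β : ℝ → ℝ} (hβ : ContinuousOn β (Icc 0 1)) :
    Tendsto (fun n : ℕ => ((n : ℝ) + 1) * ∫ s in (0 : ℝ)..1, s ^ n * β s) atTop (𝓝 (β 1)) := by
  have h := tendsto_setIntegral_pow_smul_of_unique_maximum_of_isCompact_of_continuousOn
    (μ := volume) (c := fun s : ℝ => s) (x₀ := (1 : ℝ)) (isCompact_Icc (a := (0 : ℝ)) (b := 1))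
    continuousOn_id (fun y hy hne => lt_of_le_of_ne hy.2 hne) (fun y hy => hy.1) one_pos
    (by rw [interior_Icc, closure_Ioo zero_ne_one]; exact right_mem_Icc.2 zero_le_one) hβ
  refine h.congr fun n => ?_
  rw [integral_Icc_eq_integral_Ioc, integral_Icc_eq_integral_Ioc,
    ← intervalIntegral.integral_of_le zero_le_one, ← intervalIntegral.integral_of_le zero_le_one]
  simp

theorem exists_continuous_integral_abs_sub_le {D : ℝ → ℝ} (hD : IntervalIntegrable D volume 0 1)
    {ε : ℝ} (hε : 0 < ε) :
    ∃ g : ℝ → ℝ, Continuous g ∧ ∫ s in (0 : ℝ)..1, |D s - g s| ≤ ε := by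
  obtain ⟨g, -, hg, hgc, -⟩ := Integrable.exists_hasCompactSupport_integral_sub_le hD.1 hε
  refine ⟨g, hgc, ?_⟩
  rwa [intervalIntegral.integral_of_le zero_le_one]

/-- An `L¹`-close continuous rate changes the functional little. The missing end value `e` is then
supplied by the rate `e (N + 1) s^N`: its primitive `e s^(N+1)` is negligible against `k`, while
against `β` it yields nearly `e β(1)`. -/
theorem exists_continuous_rate {D k β : ℝ → ℝ} (hD : IntervalIntegrable D volume 0 1)
    (hk : ContinuousOn k (Icc 0 1)) (hβ : ContinuousOn β (Icc 0 1)) (u₀ u₁ : ℝ) {δ : ℝ}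
    (hδ : 0 < δ) :
    ∃ g : ℝ → ℝ, Continuous g ∧ u₀ + (∫ s in (0 : ℝ)..1, g s) = u₁ ∧
      ∫ s in (0 : ℝ)..1, (k s * (u₀ + ∫ r in (0 : ℝ)..s, g r) + β s * g s) ≤
        (∫ s in (0 : ℝ)..1, (k s * (u₀ + ∫ r in (0 : ℝ)..s, D r) + β s * D s))
          + (u₁ - (u₀ + ∫ s in (0 : ℝ)..1, D s)) * β 1 + δ := by
  obtain ⟨C₁, hC₁⟩ := isCompact_Icc.exists_bound_of_continuousOn hk
  obtain ⟨C₂, hC₂⟩ := isCompact_Icc.exists_bound_of_continuousOn hβ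
  set C := max C₁ C₂ with hC
  have hkC : ∀ s ∈ Icc (0 : ℝ) 1, |k s| ≤ C := fun s hs => (hC₁ s hs).trans (le_max_left _ _)
  have hβC : ∀ s ∈ Icc (0 : ℝ) 1, |β s| ≤ C := fun s hs => (hC₂ s hs).trans (le_max_right _ _)
  have hC0 : 0 ≤ C := (abs_nonneg _).trans (hkC 0 (left_mem_Icc.2 zero_le_one))
  -- Three errors of size `C ε` (the `k` term, the `β` term, the change of end value) and one `ε`
  -- from the peak.
  set ε := δ / (3 * C + 1) with hε
  have hε0 : 0 < ε := by positivity
  obtain ⟨g, hg, hDg⟩ := exists_continuous_integral_abs_sub_le hD hε0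
  have hgi : ∀ a b, IntervalIntegrable g volume a b := fun a b => hg.intervalIntegrable a b
  have hDs : ∀ s ∈ Icc (0 : ℝ) 1, IntervalIntegrable D volume 0 s := fun s hs =>
    hD.mono_set (by
      rw [uIcc_of_le hs.1, uIcc_of_le zero_le_one]; exact Icc_subset_Icc_right hs.2)
  set Φ : ℝ → ℝ := fun s => ∫ r in (0 : ℝ)..s, (g r - D r) with hΦ
  have hΦe : ∀ s ∈ Icc (0 : ℝ) 1,
      Φ s = (∫ r in (0 : ℝ)..s, g r) - ∫ r in (0 : ℝ)..s, D r := fun s hs =>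
    intervalIntegral.integral_sub (hgi _ _) (hDs s hs)
  have hΦb : ∀ s ∈ Icc (0 : ℝ) 1, |Φ s| ≤ ε := by
    intro s hs
    refine (intervalIntegral.abs_integral_le_integral_abs hs.1).trans (le_trans ?_ hDg)
    simp only [abs_sub_comm (g _)]
    exact intervalIntegral.integral_mono_interval le_rfl hs.1 hs.2
      (Eventually.of_forall fun _ => abs_nonneg _) (hD.sub (hgi _ _)).abs
  have hgD : IntervalIntegrable (fun r => g r - D r) volume 0 1 := (hgi _ _).sub hD
  have hprim : ∀ {F : ℝ → ℝ}, IntervalIntegrable F volume 0 1 →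
      ContinuousOn (fun s => ∫ r in (0 : ℝ)..s, F r) (uIcc 0 1) := fun hF => by
    refine intervalIntegral.continuousOn_primitive_interval ?_
    rw [uIcc_of_le zero_le_one]
    exact (intervalIntegrable_iff_integrableOn_Icc_of_le zero_le_one).1 hF
  rw [← uIcc_of_le zero_le_one] at hk hβ
  have hΦc : ContinuousOn Φ (uIcc 0 1) := hprim hgD
  -- the correction that moves the end value
  set e : ℝ := u₁ - (u₀ + ∫ s in (0 : ℝ)..1, g s) with he
  have hβ' := hβ
  have hk' := hk
  rw [uIcc_of_le zero_le_one] at hβ' hk'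
  -- The first integral carries the exponent `n + 1` without its normalizing factor `n + 2`, so it
  -- tends to zero.
  have hpeak : Tendsto (fun n : ℕ => e * ((∫ s in (0 : ℝ)..1, s ^ (n + 1) * k s)
      + ((n : ℝ) + 1) * ∫ s in (0 : ℝ)..1, s ^ n * β s)) atTop (𝓝 (e * (0 + β 1))) := by
    refine (Tendsto.add ?_ (tendsto_mul_integral_pow_mul hβ')).const_mul e
    have h1 := (tendsto_mul_integral_pow_mul hk').comp (tendsto_add_atTop_nat 1)
    have h2 : Tendsto (fun n : ℕ => (((n + 1 : ℕ) : ℝ) + 1)⁻¹) atTop (𝓝 0) :=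
      (tendsto_inv_atTop_zero.comp
        (tendsto_atTop_add_const_right _ _ tendsto_natCast_atTop_atTop)).comp
        (tendsto_add_atTop_nat 1)
    have h3 := h2.mul h1
    rw [zero_mul] at h3
    refine h3.congr fun n => ?_
    have : (((n + 1 : ℕ) : ℝ) + 1) ≠ 0 := by positivity
    simp only [Function.comp_apply]
    rw [inv_mul_cancel_left₀ this]
  obtain ⟨N, hN⟩ := (hpeak.eventually_lt_const
    (show e * (0 + β 1) < e * β 1 + ε by rw [zero_add]; linarith)).exists
  have hpowi : ∀ s : ℝ, ∫ r in (0 : ℝ)..s, e * (((N : ℝ) + 1) * r ^ N) = e * s ^ (N + 1) := by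
    intro s
    have : (N : ℝ) + 1 ≠ 0 := by positivity
    rw [intervalIntegral.integral_const_mul, intervalIntegral.integral_const_mul, integral_pow]
    field_simp
    simp
  have hpc : Continuous fun r : ℝ => e * (((N : ℝ) + 1) * r ^ N) := by fun_prop
  have hprim' : ∀ s : ℝ, ∫ r in (0 : ℝ)..s, (g r + e * (((N : ℝ) + 1) * r ^ N))
      = (∫ r in (0 : ℝ)..s, g r) + e * s ^ (N + 1) := fun s => by
    rw [intervalIntegral.integral_add (hgi _ _) (hpc.intervalIntegrable _ _), hpowi]
  refine ⟨fun r => g r + e * (((N : ℝ) + 1) * r ^ N), hg.add hpc, ?_, ?_⟩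
  · rw [hprim', he]
    ring
  have hA : IntervalIntegrable (fun s => k s * (u₀ + ∫ r in (0 : ℝ)..s, D r) + β s * D s)
      volume 0 1 :=
    (hk.mul (continuousOn_const.add (hprim hD))).intervalIntegrable.add
      (hD.continuousOn_mul hβ)
  have hB1 : IntervalIntegrable (fun s => k s * Φ s) volume 0 1 := (hk.mul hΦc).intervalIntegrable
  have hB2 : IntervalIntegrable (fun s => β s * (g s - D s)) volume 0 1 := hgD.continuousOn_mul hβ
  have hC1 : IntervalIntegrable (fun s => s ^ (N + 1) * k s) volume 0 1 :=
    ((continuous_pow (N + 1)).continuousOn.mul hk).intervalIntegrable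
  have hC2 : IntervalIntegrable (fun s => s ^ N * β s) volume 0 1 :=
    ((continuous_pow N).continuousOn.mul hβ).intervalIntegrable
  have hsplit : ∫ s in (0 : ℝ)..1, (k s * (u₀ + ∫ r in (0 : ℝ)..s,
        (g r + e * (((N : ℝ) + 1) * r ^ N))) + β s * (g s + e * (((N : ℝ) + 1) * s ^ N)))
      = (∫ s in (0 : ℝ)..1, (k s * (u₀ + ∫ r in (0 : ℝ)..s, D r) + β s * D s))
        + ((∫ s in (0 : ℝ)..1, k s * Φ s) + ∫ s in (0 : ℝ)..1, β s * (g s - D s))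
        + e * ((∫ s in (0 : ℝ)..1, s ^ (N + 1) * k s)
          + ((N : ℝ) + 1) * ∫ s in (0 : ℝ)..1, s ^ N * β s) := by
    rw [← intervalIntegral.integral_const_mul ((N : ℝ) + 1),
      ← intervalIntegral.integral_add hC1 (hC2.const_mul _),
      ← intervalIntegral.integral_const_mul,
      ← intervalIntegral.integral_add hB1 hB2, ← intervalIntegral.integral_add hA (hB1.add hB2),
      ← intervalIntegral.integral_add (hA.add (hB1.add hB2))
        ((hC1.add (hC2.const_mul _)).const_mul _)]
    refine intervalIntegral.integral_congr fun s hs => ?_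
    rw [uIcc_of_le zero_le_one] at hs
    simp only [hprim', hΦe s hs]
    ring
  have hI1 : ∫ s in (0 : ℝ)..1, k s * Φ s ≤ C * ε := by
    have := intervalIntegral.integral_mono_on (μ := volume) (g := fun _ => C * ε) zero_le_one hB1
      intervalIntegrable_const fun s hs => (le_abs_self _).trans (by
        rw [abs_mul]
        exact mul_le_mul (hkC s hs) (hΦb s hs) (abs_nonneg _) hC0)
    simpa using this
  have hI2 : ∫ s in (0 : ℝ)..1, β s * (g s - D s) ≤ C * ε := by
    have := intervalIntegral.integral_mono_on (μ := volume) (g := fun s => C * |D s - g s|)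
      zero_le_one hB2 ((hD.sub (hgi _ _)).abs.const_mul _) fun s hs => (le_abs_self _).trans (by
        rw [abs_mul, abs_sub_comm]
        exact mul_le_mul_of_nonneg_right (hβC s hs) (abs_nonneg _))
    rw [intervalIntegral.integral_const_mul] at this
    exact this.trans (mul_le_mul_of_nonneg_left hDg hC0)
  have h1mem : (1 : ℝ) ∈ Icc (0 : ℝ) 1 := right_mem_Icc.2 zero_le_one
  have hI3 : e * β 1 ≤ (u₁ - (u₀ + ∫ s in (0 : ℝ)..1, D s)) * β 1 + C * ε := by
    have h1 : e = (u₁ - (u₀ + ∫ s in (0 : ℝ)..1, D s)) - Φ 1 := by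
      rw [hΦe 1 h1mem, he]; ring
    have h2 : -(Φ 1 * β 1) ≤ ε * C := (neg_le_abs _).trans (by
      rw [abs_mul]
      exact mul_le_mul (hΦb 1 h1mem) (hβC 1 h1mem) (abs_nonneg _) hε0.le)
    rw [h1, sub_mul]
    linarith
  have hfin : ε * (3 * C + 1) = δ := by rw [hε]; field_simp
  rw [hsplit]
  nlinarith

/-! ### The variation field generated by a control along a curve -/

section Control

variable {n m : ℕ} {f : Vec n → Vec n} {b : Fin m → Vec n → Vec n}
  {M : ℝ → Vec n → (Vec n →L[ℝ] Vec n)}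

/-- Links the contraction condition to the first variation: the form is the derivative of `vᵀ M v`
along the nominal flow and its linearization. -/
theorem contractionForm_eq_fderiv (hM : ContDiff ℝ 1 fun z : ℝ × Vec n => M z.1 z.2) (t : ℝ)
    (x v : Vec n) (u : Vec m) :
    contractionForm f b M t x u v
      = fderiv ℝ (metricForm M) (t, x, v) (1, nominalField f b x u, diffA f b x u v) := by
  rw [fderiv_metricForm hM]
  rfl

theorem fderiv_metricForm_snd_snd (hM : ContDiff ℝ 1 fun z : ℝ × Vec n => M z.1 z.2) {t : ℝ}
    (hsymm : ∀ x v w, inner ℝ v (M t x w) = inner ℝ (M t x v) w) (x v u : Vec n) :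
    fderiv ℝ (metricForm M) (t, x, v) (0, 0, u) = 2 * inner ℝ v (M t x u) := by
  -- `fderiv_metricForm` covers only directions with time component 1.
  have h : ((0 : ℝ), (0 : Vec n), u) = (1, 0, u) - (1, 0, 0) := by simp
  rw [h, map_sub, fderiv_metricForm hM, fderiv_metricForm hM]
  have h2 : inner ℝ u (M t x v) = inner ℝ v (M t x u) := by
    rw [hsymm x v u, real_inner_comm]
  simp [h2]
  ring

/-- The variation integrand is affine in the control and its rate, so the choice of profile splits
into one scalar problem per input channel. -/
theorem fderiv_metricForm_control (t : ℝ) (x v : Vec n) (u d : Fin m → ℝ) :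
    fderiv ℝ (metricForm M) (t, x, v) (1, f x + ∑ i, u i • b i x,
        (fderiv ℝ f x + ∑ i, u i • fderiv ℝ (b i) x) v + ∑ i, d i • b i x)
      = fderiv ℝ (metricForm M) (t, x, v) (1, f x, fderiv ℝ f x v)
        + ∑ i, (fderiv ℝ (metricForm M) (t, x, v) (0, b i x, fderiv ℝ (b i) x v) * u i
          + fderiv ℝ (metricForm M) (t, x, v) (0, 0, b i x) * d i) := by
  have h : ((1 : ℝ), f x + ∑ i, u i • b i x,
        (fderiv ℝ f x + ∑ i, u i • fderiv ℝ (b i) x) v + ∑ i, d i • b i x)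
      = (1, f x, fderiv ℝ f x v) + ∑ i, (u i • ((0 : ℝ), b i x, fderiv ℝ (b i) x v)
          + d i • ((0 : ℝ), (0 : Vec n), b i x)) := by
    refine Prod.ext ?_ (Prod.ext ?_ ?_)
    · simp [Prod.fst_sum]
    · simp [Prod.fst_sum, Prod.snd_sum]
    · simp [Prod.snd_sum, Finset.sum_add_distrib, sum_apply, add_assoc]
  rw [h, map_add, map_sum]
  simp only [map_add, map_smul, smul_eq_mul, mul_comm]

theorem hasDerivWithinAt_control (hf : ContDiff ℝ 1 f) (hb : ∀ i, ContDiff ℝ 1 (b i))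
    {γ : ℝ → Vec n} (hγ : ContDiffOn ℝ 1 γ (Icc 0 1)) {g : Fin m → ℝ → ℝ}
    (hg : ∀ i, Continuous (g i)) (u₀ : Fin m → ℝ) {s : ℝ} (hs : s ∈ Icc (0 : ℝ) 1) :
    HasDerivWithinAt
      (fun s => f (γ s) + ∑ i, (u₀ i + ∫ r in (0 : ℝ)..s, g i r) • b i (γ s))
      ((fderiv ℝ f (γ s) + ∑ i, (u₀ i + ∫ r in (0 : ℝ)..s, g i r) • fderiv ℝ (b i) (γ s))
        (velocity γ s) + ∑ i, g i s • b i (γ s)) (Icc 0 1) s := by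
  have hv := hγ.hasDerivWithinAt_velocity hs
  have h1 : HasDerivWithinAt (fun s => f (γ s)) (fderiv ℝ f (γ s) (velocity γ s)) (Icc 0 1) s :=
    ((hf.differentiable one_ne_zero (γ s)).hasFDerivAt).comp_hasDerivWithinAt s hv
  have h2 : ∀ i, HasDerivWithinAt (fun s => b i (γ s)) (fderiv ℝ (b i) (γ s) (velocity γ s))
      (Icc 0 1) s := fun i =>
    (((hb i).differentiable one_ne_zero (γ s)).hasFDerivAt).comp_hasDerivWithinAt s hv
  have h3 : ∀ i, HasDerivWithinAt (fun s => u₀ i + ∫ r in (0 : ℝ)..s, g i r) (g i s)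
      (Icc 0 1) s := fun i =>
    (((hg i).integral_hasStrictDerivAt 0 s).hasDerivAt.const_add (u₀ i)).hasDerivWithinAt
  refine (h1.add (HasDerivWithinAt.fun_sum fun i _ => (h3 i).smul (h2 i))).congr_deriv ?_
  simp [Finset.sum_add_distrib, sum_apply, add_assoc]

theorem contDiffOn_one_of_hasDerivWithinAt {c c' : ℝ → Vec n}
    (hc : ∀ s ∈ Icc (0 : ℝ) 1, HasDerivWithinAt c (c' s) (Icc 0 1) s)
    (hc' : ContinuousOn c' (Icc 0 1)) : ContDiffOn ℝ 1 c (Icc 0 1) := by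
  have hu := uniqueDiffOn_Icc (zero_lt_one (α := ℝ))
  refine (contDiffOn_one_iff_derivWithin hu).2
    ⟨fun s hs => (hc s hs).differentiableWithinAt, hc'.congr fun s hs => ?_⟩
  exact (hc s hs).derivWithin (hu s hs)

/-- Along a curve `γ`, a controller obtained by integrating a differential controller gives, up to
an arbitrarily small error, a `C¹` variation field with the velocities of the two end points, also
when a different control value `u₁` is applied at the end `γ 1`. -/
theorem IsCCMControl.exists_variation (hf : ContDiff ℝ 1 f) (hb : ∀ i, ContDiff ℝ 1 (b i))
    (hM : ContDiff ℝ 1 fun z : ℝ × Vec n => M z.1 z.2) {t : ℝ} (ht : 0 ≤ t)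
    (hsymm : ∀ x v w, inner ℝ v (M t x w) = inner ℝ (M t x v) w) {lam : ℝ}
    {δu : ℝ → Vec n → Vec n → Vec m → Vec m} (hδu : IsDifferentialController f b M lam δu)
    {γ : ℝ → Vec n} (hγ : ContDiffOn ℝ 1 γ (Icc 0 1)) {ud u : Vec m}
    (hu : IsCCMControl δu t γ ud u) (u₁ : Vec m) {r : ℝ}
    (hr : -2 * lam * curveEnergy M t γ
      + ∑ i, (u₁ i - u i) * (2 * inner ℝ (velocity γ 1) (M t (γ 1) (b i (γ 1)))) < r) :
    ∃ w : ℝ → Vec n, IsCurve w (nominalField f b (γ 0) ud) (nominalField f b (γ 1) u₁) ∧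
      ∫ s in (0 : ℝ)..1, fderiv ℝ (metricForm M) (t, γ s, velocity γ s) (1, w s, velocity w s)
        < r := by
  obtain ⟨ν, hD, hν, rfl⟩ := hu
  set D : Fin m → ℝ → ℝ := fun i s => δu t (γ s) (velocity γ s) (ν s) i with hDdef
  have hDi : ∀ i, IntervalIntegrable (D i) volume 0 1 := fun i =>
    ⟨(EuclideanSpace.proj (𝕜 := ℝ) i).integrable_comp hD.1,
      (EuclideanSpace.proj (𝕜 := ℝ) i).integrable_comp hD.2⟩
  have hνi : ∀ i, ∀ s ∈ Icc (0 : ℝ) 1, ν s i = ud i + ∫ r in (0 : ℝ)..s, D i r := by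
    intro i s hs
    have hDs : IntervalIntegrable (fun s => δu t (γ s) (velocity γ s) (ν s)) volume 0 s :=
      hD.mono_set (by
        rw [uIcc_of_le hs.1, uIcc_of_le zero_le_one]; exact Icc_subset_Icc_right hs.2)
    have := (EuclideanSpace.proj i : Vec m →L[ℝ] ℝ).intervalIntegral_comp_comm hDs
    rw [hν s hs]
    simpa [hDdef] using this.symm
  have hγc := hγ.continuousOn
  have hvc := hγ.continuousOn_velocity
  have hzc : ContinuousOn (fun s => fderiv ℝ (metricForm M) (t, γ s, velocity γ s)) (Icc 0 1) :=
    ((contDiff_metricForm hM).continuous_fderiv one_ne_zero).comp_continuousOn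
      (continuousOn_const.prodMk (hγc.prodMk hvc))
  have hbc : ∀ i, ContinuousOn (fun s => b i (γ s)) (Icc 0 1) := fun i =>
    (hb i).continuous.comp_continuousOn hγc
  have hdf : ContinuousOn (fun s => fderiv ℝ f (γ s)) (Icc 0 1) :=
    (hf.continuous_fderiv one_ne_zero).comp_continuousOn hγc
  have hdb : ∀ i, ContinuousOn (fun s => fderiv ℝ (b i) (γ s)) (Icc 0 1) := fun i =>
    ((hb i).continuous_fderiv one_ne_zero).comp_continuousOn hγc
  set k₀ : ℝ → ℝ := fun s => fderiv ℝ (metricForm M) (t, γ s, velocity γ s)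
    (1, f (γ s), fderiv ℝ f (γ s) (velocity γ s)) with hk₀
  set k : Fin m → ℝ → ℝ := fun i s => fderiv ℝ (metricForm M) (t, γ s, velocity γ s)
    (0, b i (γ s), fderiv ℝ (b i) (γ s) (velocity γ s)) with hk
  set β : Fin m → ℝ → ℝ := fun i s => fderiv ℝ (metricForm M) (t, γ s, velocity γ s)
    (0, 0, b i (γ s)) with hβ
  have hk₀c : ContinuousOn k₀ (Icc 0 1) := hzc.clm_apply
    (continuousOn_const.prodMk ((hf.continuous.comp_continuousOn hγc).prodMk (hdf.clm_apply hvc)))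
  have hkc : ∀ i, ContinuousOn (k i) (Icc 0 1) := fun i => hzc.clm_apply
    (continuousOn_const.prodMk ((hbc i).prodMk ((hdb i).clm_apply hvc)))
  have hβc : ∀ i, ContinuousOn (β i) (Icc 0 1) := fun i => hzc.clm_apply
    (continuousOn_const.prodMk (continuousOn_const.prodMk (hbc i)))
  have hβ1 : ∀ i, β i 1 = 2 * inner ℝ (velocity γ 1) (M t (γ 1) (b i (γ 1))) := fun i =>
    fderiv_metricForm_snd_snd hM hsymm _ _ _
  set J : (Fin m → ℝ → ℝ) → Fin m → ℝ → ℝ := fun g i s =>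
    k i s * (ud i + ∫ r in (0 : ℝ)..s, g i r) + β i s * g i s with hJ
  have hprim : ∀ {F : ℝ → ℝ}, IntervalIntegrable F volume 0 1 →
      ContinuousOn (fun s => ∫ r in (0 : ℝ)..s, F r) (uIcc 0 1) := fun hF => by
    refine intervalIntegral.continuousOn_primitive_interval ?_
    rw [uIcc_of_le zero_le_one]
    exact (intervalIntegrable_iff_integrableOn_Icc_of_le zero_le_one).1 hF
  have hJi : ∀ {g : Fin m → ℝ → ℝ}, (∀ i, IntervalIntegrable (g i) volume 0 1) → ∀ i,
      IntervalIntegrable (J g i) volume 0 1 := fun {g} hg i => by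
    have h1 := hkc i
    have h2 := hβc i
    rw [← uIcc_of_le zero_le_one] at h1 h2
    exact (h1.mul (continuousOn_const.add (hprim (hg i)))).intervalIntegrable.add
      ((hg i).continuousOn_mul h2)
  have hJs : ∀ {g : Fin m → ℝ → ℝ}, (∀ i, IntervalIntegrable (g i) volume 0 1) →
      IntervalIntegrable (fun s => ∑ i, J g i s) volume 0 1 := fun {g} hg => by
    have h := IntervalIntegrable.sum Finset.univ fun i _ => hJi hg i
    rwa [Finset.sum_fn] at h
  have hk₀i : IntervalIntegrable k₀ volume 0 1 := by
    rw [← uIcc_of_le zero_le_one] at hk₀c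
    exact hk₀c.intervalIntegrable
  have hsum : ∀ {g : Fin m → ℝ → ℝ}, (∀ i, IntervalIntegrable (g i) volume 0 1) →
      ∫ s in (0 : ℝ)..1, (k₀ s + ∑ i, J g i s)
        = (∫ s in (0 : ℝ)..1, k₀ s) + ∑ i, ∫ s in (0 : ℝ)..1, J g i s := fun {g} hg => by
    rw [intervalIntegral.integral_add hk₀i (hJs hg),
      intervalIntegral.integral_finsetSum fun i _ => hJi hg i]
  -- the decay provided by the differential controller
  have hdecay : ∫ s in (0 : ℝ)..1, (k₀ s + ∑ i, J D i s) ≤ -2 * lam * curveEnergy M t γ := by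
    have hE := continuousOn_metric_velocity hM.continuous t hγ
    rw [← uIcc_of_le zero_le_one] at hE
    rw [curveEnergy, ← intervalIntegral.integral_const_mul]
    refine intervalIntegral.integral_mono_on zero_le_one (hk₀i.add (hJs hDi))
      (hE.intervalIntegrable.const_mul _) fun s hs => ?_
    refine le_trans (le_of_eq ?_) (hδu t ht (γ s) (velocity γ s) (ν s))
    rw [contractionForm_eq_fderiv hM, ← fderiv_metricForm_snd_snd hM hsymm, ← map_add]
    have h2 := fderiv_metricForm_control (f := f) (b := b) (M := M) t (γ s) (velocity γ s)
      (fun i => ν s i) (fun i => D i s)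
    simp only [hJ, ← hνi _ s hs]
    refine h2.symm.trans ?_
    congr 1
    simp [nominalField, diffA, hDdef]
  set Δ := r - (-2 * lam * curveEnergy M t γ + ∑ i, (u₁ i - ν 1 i) * β i 1) with hΔ
  have hΔ0 : 0 < Δ := by
    simp only [hΔ, hβ1]
    linarith
  -- The slack `Δ` is shared among `m` channels; dividing by `m + 1` keeps the total strictly below
  -- `Δ`, also for `m = 0`.
  choose g hg hg1 hgle using fun i => exists_continuous_rate (hDi i) (hkc i) (hβc i) (ud i) (u₁ i)
    (δ := Δ / (m + 1)) (by positivity)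
  have hgi : ∀ i, IntervalIntegrable (g i) volume 0 1 := fun i => (hg i).intervalIntegrable _ _
  have hder := fun s (hs : s ∈ Icc (0 : ℝ) 1) =>
    hasDerivWithinAt_control hf hb hγ hg (fun i => ud i) hs
  refine ⟨fun s => f (γ s) + ∑ i, (ud i + ∫ r in (0 : ℝ)..s, g i r) • b i (γ s), ⟨?_, ?_, ?_⟩, ?_⟩
  · refine contDiffOn_one_of_hasDerivWithinAt hder ?_
    have hp : ∀ i, ContinuousOn (fun s => ud i + ∫ r in (0 : ℝ)..s, g i r) (Icc 0 1) := fun i => by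
      have := hprim (hgi i)
      rw [uIcc_of_le zero_le_one] at this
      exact continuousOn_const.add this
    exact ((hdf.add (continuousOn_finsetSum _ fun i _ => (hp i).smul (hdb i))).clm_apply hvc).add
      (continuousOn_finsetSum _ fun i _ => (hg i).continuousOn.smul (hbc i))
  · simp [nominalField]
  · simp [nominalField, hg1]
  · have hint : ∫ s in (0 : ℝ)..1, fderiv ℝ (metricForm M) (t, γ s, velocity γ s)
        (1, f (γ s) + ∑ i, (ud i + ∫ r in (0 : ℝ)..s, g i r) • b i (γ s),
          velocity (fun s => f (γ s) + ∑ i, (ud i + ∫ r in (0 : ℝ)..s, g i r) • b i (γ s)) s)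
        = ∫ s in (0 : ℝ)..1, (k₀ s + ∑ i, J g i s) := by
      refine intervalIntegral.integral_congr fun s hs => ?_
      rw [uIcc_of_le zero_le_one] at hs
      simp only [velocity_eq hs (hder s hs)]
      exact fderiv_metricForm_control t (γ s) (velocity γ s) _ fun i => g i s
    rw [hint, hsum hgi]
    rw [hsum hDi] at hdecay
    have h1 := Finset.sum_le_sum fun i (_ : i ∈ Finset.univ) => hgle i
    simp only [← hνi _ 1 (right_mem_Icc.2 zero_le_one)] at h1
    rw [Finset.sum_add_distrib, Finset.sum_add_distrib] at h1
    simp only [Finset.sum_const, Finset.card_univ, Fintype.card_fin, nsmul_eq_mul] at h1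
    have h2 : (m : ℝ) * (Δ / (m + 1)) < Δ := by
      rw [← mul_div_assoc, div_lt_iff₀ (by positivity)]
      nlinarith
    have h3 : r = Δ + (-2 * lam * curveEnergy M t γ + ∑ i, (u₁ i - ν 1 i) * β i 1) := by
      rw [hΔ]; ring
    rw [h3]
    simp only [hJ] at hdecay ⊢
    linarith

end Control

/-! ### The robust tracking bound -/

theorem norm_sub_le_of_mem_Icc {p : ℕ} {lo hi x y : Vec p} (hx : ∀ k, x k ∈ Icc (lo k) (hi k))
    (hy : ∀ k, y k ∈ Icc (lo k) (hi k)) : ‖x - y‖ ≤ ‖hi - lo‖ := by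
  rw [EuclideanSpace.norm_eq, EuclideanSpace.norm_eq]
  refine Real.sqrt_le_sqrt (Finset.sum_le_sum fun k _ => ?_)
  refine pow_le_pow_left₀ (norm_nonneg _) ?_ 2
  simp only [PiLp.sub_apply, Real.norm_eq_abs]
  refine (abs_le.2 ⟨?_, ?_⟩).trans (le_abs_self _) <;>
    linarith [(hx k).1, (hx k).2, (hy k).1, (hy k).2]

/-- The robustifying term dominates the cross term with the parameter error. -/
theorem two_mul_mul_sub_le {P : Type*} [NormedAddCommGroup P] [InnerProductSpace ℝ P] {κ : ℝ}
    (hκ : 0 < κ) (y : ℝ) (φ e : P) {R : ℝ} (he : ‖e‖ ≤ R) :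
    (inner ℝ φ e - κ * y * ‖φ‖ ^ 2) * (2 * y) ≤ R ^ 2 / (2 * κ) := by
  have h1 : inner ℝ φ e * y ≤ ‖φ‖ * R * |y| :=
    calc inner ℝ φ e * y ≤ |inner ℝ φ e * y| := le_abs_self _
      _ = |inner ℝ φ e| * |y| := abs_mul _ _
      _ ≤ ‖φ‖ * R * |y| := by
        gcongr
        exact (abs_real_inner_le_norm _ _).trans (by gcongr)
  rw [le_div_iff₀ (by positivity)]
  -- Completing the square; the worst case is `‖φ‖ |y| = R / (2κ)`.
  have h2 : 0 ≤ (R - 2 * κ * (‖φ‖ * |y|)) ^ 2 := sq_nonneg _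
  have h3 : |y| ^ 2 = y ^ 2 := sq_abs y
  have h4 : (R - 2 * κ * (‖φ‖ * |y|)) ^ 2
      = R ^ 2 - 4 * κ * (‖φ‖ * R * |y|) + 4 * κ ^ 2 * ‖φ‖ ^ 2 * y ^ 2 := by
    rw [← h3]; ring
  nlinarith

theorem le_of_eventually_slope_lt {E : ℝ → ℝ} {t e : ℝ}
    (h : ∀ r > e, ∀ᶠ h in 𝓝[>] (0 : ℝ), h⁻¹ * (E (t + h) - E t) < r) {E' : ℝ}
    (hE : HasDerivWithinAt E E' (Ici t) t) : E' ≤ e := by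
  refine le_of_forall_gt_imp_ge_of_dense fun r hr => ?_
  exact le_of_tendsto hE.tendsto_slope_right_sub ((h r hr).mono fun _ h => h.le)

theorem upperRightDini_le_of_eventually_slope_lt {E : ℝ → ℝ} {t e : ℝ}
    (h : ∀ r > e, ∀ᶠ h in 𝓝[>] (0 : ℝ), h⁻¹ * (E (t + h) - E t) < r) :
    upperRightDini E t ≤ (e : EReal) := by
  refine EReal.le_of_forall_lt_iff_le.1 fun r hr => ?_
  refine limsup_le_of_le (by isBoundedDefault)
    ((h r (EReal.coe_lt_coe_iff.1 hr)).mono fun x hx => ?_)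
  rw [div_eq_inv_mul]
  exact EReal.coe_le_coe_iff.2 hx.le

/-- Grönwall's inequality needs only continuity and a bound on right slopes, and it admits the
negative rate `-2 lam`. -/
theorem le_exp_of_eventually_slope_lt {E : ℝ → ℝ} {lam C T : ℝ} (hlam : 0 < lam)
    (hE : ContinuousOn E (Icc 0 T))
    (h : ∀ t ∈ Ico 0 T, ∀ r > -2 * lam * E t + C,
      ∀ᶠ h in 𝓝[>] (0 : ℝ), h⁻¹ * (E (t + h) - E t) < r) :
    ∀ t ∈ Icc 0 T, E t ≤ E 0 * Real.exp (-2 * lam * t)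
      + C / (2 * lam) * (1 - Real.exp (-2 * lam * t)) := by
  intro t ht
  have key := le_gronwallBound_of_liminf_deriv_right_le (f' := fun t => -2 * lam * E t + C)
    (δ := E 0) (K := -2 * lam) (ε := C) hE (fun s hs r hr => ?_) le_rfl (fun _ _ => le_rfl) t ht
  · rw [gronwallBound_of_K_ne_0 (by linarith), sub_zero] at key
    refine key.trans_eq ?_
    field_simp
    ring
  · have hmap : Tendsto (fun z : ℝ => z - s) (𝓝[>] s) (𝓝[>] 0) := by
      refine tendsto_nhdsWithin_iff.2 ⟨?_, ?_⟩
      · have hc : Continuous fun z : ℝ => z - s := by fun_prop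
        simpa using (hc.tendsto s).mono_left nhdsWithin_le_nhds
      · filter_upwards [self_mem_nhdsWithin] with z hz
        simpa using hz
    refine ((hmap.eventually (h s hs r hr)).mono fun z hz => ?_).frequently
    simpa using hz

section

variable {n m p : ℕ} {f : Vec n → Vec n} {b : Fin m → Vec n → Vec n}
  {M : ℝ → Vec n → (Vec n →L[ℝ] Vec n)}

/-- Under matched uncertainty the closed loop is the nominal system with a perturbed control. -/
theorem closedLoop_eq_nominalField {Δ : Fin p → Vec n → Vec n} {φ : Fin m → Vec n → Vec p}
    {θ : Vec p} (hmatch : ∀ x, ∑ k, θ k • Δ k x = ∑ i, (inner ℝ (φ i x) θ : ℝ) • b i x) (x : Vec n)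
    (u : Fin m → ℝ) :
    f x - ∑ k, θ k • Δ k x + ∑ i, u i • b i x
      = nominalField f b x (WithLp.toLp 2 fun i => u i - inner ℝ (φ i x) θ) := by
  rw [hmatch, nominalField]
  simp only [sub_smul, Finset.sum_sub_distrib]
  abel

/-- By symmetry of `M`, the weight of channel `i` in the end point cost is twice the quantity fed
back by the robustifying term, so `two_mul_mul_sub_le` applies channel by channel. -/
theorem sum_robustControl_le {κ : ℝ} (hκ : 0 < κ) {t : ℝ}
    (hsymm : ∀ x v w, inner ℝ v (M t x w) = inner ℝ (M t x v) w) (φ : Fin m → Vec n → Vec p)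
    (γ : ℝ → Vec n) (u : Vec m) {θ θhat : Vec p} {R : ℝ} (hR : ‖θhat - θ‖ ≤ R) :
    ∑ i, (robustControl b φ M κ t (γ 1) γ u θhat i - inner ℝ (φ i (γ 1)) θ - u i)
        * (2 * inner ℝ (velocity γ 1) (M t (γ 1) (b i (γ 1)))) ≤ m / (2 * κ) * R ^ 2 := by
  have h : ∀ i, (robustControl b φ M κ t (γ 1) γ u θhat i - inner ℝ (φ i (γ 1)) θ - u i)
      * (2 * inner ℝ (velocity γ 1) (M t (γ 1) (b i (γ 1)))) ≤ R ^ 2 / (2 * κ) := fun i => by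
    have h1 : inner ℝ (velocity γ 1) (M t (γ 1) (b i (γ 1)))
        = inner ℝ (b i (γ 1)) (M t (γ 1) (velocity γ 1)) := by
      rw [hsymm, real_inner_comm]
    have h2 := two_mul_mul_sub_le hκ (inner ℝ (b i (γ 1)) (M t (γ 1) (velocity γ 1)))
      (φ i (γ 1)) (θhat - θ) hR
    rw [inner_sub_right] at h2
    rw [h1, robustControl]
    refine le_trans (le_of_eq ?_) h2
    ring
  refine (Finset.sum_le_sum fun i _ => h i).trans_eq ?_
  simp
  ring

end

theorem sqrt_add_le_add_sqrt (x y : ℝ) : √(x + y) ≤ √x + √y := by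
  refine Real.sqrt_le_iff.2 ⟨by positivity, ?_⟩
  have hx := (le_max_left x 0).trans_eq (Real.sq_sqrt' (x := x)).symm
  have hy := (le_max_left y 0).trans_eq (Real.sq_sqrt' (x := y)).symm
  nlinarith [mul_nonneg (Real.sqrt_nonneg x) (Real.sqrt_nonneg y)]

theorem norm_le_of_energy_le {a₁ a₂ E E₀ x x₀ c R e lam t : ℝ} (ha₁ : 0 < a₁) (hx : 0 ≤ x)
    (hx₀ : 0 ≤ x₀) (hlow : a₁ * x ^ 2 ≤ E) (hup : E₀ ≤ a₂ * x₀ ^ 2)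
    (hE : E ≤ E₀ * Real.exp (-2 * lam * t) + c * R ^ 2 * e) (hR : 0 ≤ R) (he : 0 ≤ e) :
    x ≤ √(a₂ / a₁) * x₀ * Real.exp (-lam * t) + √(1 / a₁) * √c * R * √e := by
  have hexp : Real.exp (-2 * lam * t) = Real.exp (-lam * t) ^ 2 := by
    rw [← Real.exp_nat_mul]
    ring_nf
  set y := Real.exp (-lam * t) with hy
  have hy0 : 0 ≤ y := (Real.exp_pos _).le
  have h1 : x ^ 2 ≤ a₂ / a₁ * (x₀ * y) ^ 2 + 1 / a₁ * c * (R ^ 2 * e) := by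
    have h2 : a₁ * x ^ 2 ≤ a₂ * x₀ ^ 2 * y ^ 2 + c * R ^ 2 * e := by
      rw [hexp] at hE
      have := mul_le_mul_of_nonneg_right hup (sq_nonneg y)
      linarith
    rw [← le_div_iff₀' ha₁] at h2
    refine h2.trans_eq ?_
    field_simp
  calc x = √(x ^ 2) := (Real.sqrt_sq hx).symm
    _ ≤ √(a₂ / a₁ * (x₀ * y) ^ 2 + 1 / a₁ * c * (R ^ 2 * e)) := Real.sqrt_le_sqrt h1
    _ ≤ √(a₂ / a₁ * (x₀ * y) ^ 2) + √(1 / a₁ * c * (R ^ 2 * e)) := sqrt_add_le_add_sqrt _ _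
    _ = √(a₂ / a₁) * (x₀ * y) + √(1 / a₁) * √c * (R * √e) := by
      rw [Real.sqrt_mul' _ (sq_nonneg _), Real.sqrt_sq (mul_nonneg hx₀ hy0),
        Real.sqrt_mul' _ (mul_nonneg (sq_nonneg _) he), Real.sqrt_mul (by positivity : 0 ≤ 1 / a₁),
        Real.sqrt_mul (sq_nonneg R), Real.sqrt_sq hR]
    _ = _ := by ring

theorem mainTheorem4 {n m p : ℕ}
    -- the uncertain system `ẋ = f(x) - Δ(x)ᵀ θ + B(x) u`; `Δ k` is the `k`-th row of `Δ`
    (f : Vec n → Vec n) (b : Fin m → Vec n → Vec n) (Δ : Fin p → Vec n → Vec n)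
    (hf : ContDiff ℝ 1 f) (hb : ∀ i, ContDiff ℝ 1 (b i))
    -- bounded parameters
    (θ θlo θhi : Vec p) (hθ : ∀ k, θ k ∈ Set.Icc (θlo k) (θhi k))
    -- matched uncertainty, `Δ(x)ᵀ θ = B(x) φ(x)ᵀ θ`
    (φ : Fin m → Vec n → Vec p)
    (hmatch : ∀ x, ∑ k, θ k • Δ k x = ∑ i, (inner ℝ (φ i x) θ : ℝ) • b i x)
    -- a control contraction metric of the nominal system and a differential controller for it
    (M : ℝ → Vec n → (Vec n →L[ℝ] Vec n)) (lam α₁ α₂ : ℝ)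
    (hM : IsControlContractionMetric f b M lam α₁ α₂)
    (δu : ℝ → Vec n → Vec n → Vec m → Vec m) (hδu : IsDifferentialController f b M lam δu)
    (κ : ℝ) (hκ : 0 < κ)
    -- a feasible desired trajectory of the nominal system
    (T : ℝ) (xd : ℝ → Vec n) (ud : ℝ → Vec m)
    (hxd : IsTrajectoryOn T xd (fun t => nominalField f b (xd t) (ud t)))
    -- the closed loop
    (x : ℝ → Vec n) (γ : ℝ → ℝ → Vec n) (uccm : ℝ → Vec m) (θhat : ℝ → Vec p)
    (hθhat : ∀ t ∈ Set.Ico 0 T, ∀ k, θhat t k ∈ Set.Icc (θlo k) (θhi k))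
    (hγ : ∀ t ∈ Set.Ico 0 T, IsMinimalGeodesic M t (γ t) (xd t) (x t))
    (huccm : ∀ t ∈ Set.Ico 0 T, IsCCMControl δu t (γ t) (ud t) (uccm t))
    (hx : IsTrajectoryOn T x (fun t => f (x t) - ∑ k, θ k • Δ k (x t)
      + ∑ i, robustControl b φ M κ t (x t) (γ t) (uccm t) (θhat t) i • b i (x t))) :
    let E : ℝ → ℝ := fun t => riemEnergy M t (xd t) (x t)
    let K : ℝ := m / (2 * κ)
    -- the differential inequality
    (∀ t ∈ Set.Ico 0 T,
      upperRightDini E t ≤ ((-2 * lam * E t + K * ‖θhi - θlo‖ ^ 2 : ℝ) : EReal) ∧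
      ∀ E' : ℝ, HasDerivWithinAt E E' (Set.Ici t) t →
        E' ≤ -2 * lam * E t + K * ‖θhi - θlo‖ ^ 2) ∧
    -- the Riemannian energy is exponentially bounded
    (∀ t ∈ Set.Ico 0 T,
      E t ≤ E 0 * Real.exp (-2 * lam * t)
        + K * ‖θhi - θlo‖ ^ 2 / (2 * lam) * (1 - Real.exp (-2 * lam * t))) ∧
    -- the tracking error is exponentially bounded
    (∀ t ∈ Set.Ico 0 T,
      ‖x t - xd t‖ ≤ √(α₂ / α₁) * ‖x 0 - xd 0‖ * Real.exp (-lam * t)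
        + √(1 / α₁) * √(K / (2 * lam)) * ‖θhi - θlo‖ * √(1 - Real.exp (-2 * lam * t))) := by
  intro E K
  have hM1 := hM.contDiff
  have hMc := hM1.continuous
  have hpos : ∀ t, 0 ≤ t → ∀ x v, 0 ≤ inner ℝ v (M t x v) := fun t ht x v =>
    (mul_nonneg hM.lower_pos.le (sq_nonneg ‖v‖)).trans (hM.lower t ht x v)
  have hslope : ∀ t ∈ Ico 0 T, ∀ r > -2 * lam * E t + K * ‖θhi - θlo‖ ^ 2,
      ∀ᶠ h in 𝓝[>] (0 : ℝ), h⁻¹ * (E (t + h) - E t) < r := by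
    intro t ht r hr
    have hc := (hγ t ht).isCurve
    have hsymm := hM.symm t ht.1
    have hsum := sum_robustControl_le (b := b) hκ hsymm φ (γ t) (uccm t)
      (norm_sub_le_of_mem_Icc (hθhat t ht) hθ)
    have hx' := hx.2 t ht
    have hxd' := hxd.2 t ht
    dsimp only at hx' hxd'
    rw [closedLoop_eq_nominalField hmatch] at hx'
    rw [hc.target] at hsum
    -- The prescribed end value is the control the nominal system effectively receives, with the
    -- matched uncertainty subtracted.
    obtain ⟨w, hw, hwr⟩ := (huccm t ht).exists_variation hf hb hM1 ht.1 hsymm hδu hc.contDiffOn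
      (WithLp.toLp 2 fun i => robustControl b φ M κ t (x t) (γ t) (uccm t) (θhat t) i
        - inner ℝ (φ i (x t)) θ) (r := r) (by
        refine lt_of_le_of_lt ?_ hr
        rw [← (hγ t ht).riemEnergy_eq, hc.target]
        exact add_le_add_right hsum _)
    rw [hc.source, hc.target] at hw
    exact eventually_slope_riemEnergy_lt hM1 hpos ht.1 hxd' hx' (hγ t ht) hw hwr
  have hcont : ∀ t ∈ Ico 0 T, ContinuousOn E (Icc 0 t) := fun t ht =>
    continuousOn_riemEnergy hMc hM.lower_pos hM.lower hM.upper
      (hxd.1.mono (Icc_subset_Ico_right ht.2)) (hx.1.mono (Icc_subset_Ico_right ht.2))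
      fun s hs => hγ s (Icc_subset_Ico_right ht.2 hs)
  have hexp : ∀ t ∈ Ico 0 T, E t ≤ E 0 * Real.exp (-2 * lam * t)
      + K * ‖θhi - θlo‖ ^ 2 / (2 * lam) * (1 - Real.exp (-2 * lam * t)) := fun t ht =>
    le_exp_of_eventually_slope_lt hM.rate_pos (hcont t ht)
      (fun s hs => hslope s ⟨hs.1, hs.2.trans ht.2⟩) t (right_mem_Icc.2 ht.1)
  refine ⟨fun t ht => ⟨upperRightDini_le_of_eventually_slope_lt (hslope t ht), fun E' hE' =>
    le_of_eventually_slope_lt (hslope t ht) hE'⟩, hexp, fun t ht => ?_⟩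
  refine norm_le_of_energy_le (E := E t) (E₀ := E 0) hM.lower_pos (norm_nonneg _) (norm_nonneg _)
    ?_ (riemEnergy_le_mul_norm_sq hMc (hpos 0 le_rfl) (hM.upper 0 le_rfl) _ _) ?_ (norm_nonneg _) ?_
  · have := mul_norm_sq_le_curveEnergy hMc hM.lower_pos.le (hM.lower t ht.1) (hγ t ht).isCurve
    rwa [← (hγ t ht).riemEnergy_eq] at this
  · refine (hexp t ht).trans_eq ?_
    ring
  · refine sub_nonneg.2 (Real.exp_le_one_iff.2 ?_)
    nlinarith [hM.rate_pos, ht.1, mul_nonneg hM.rate_pos.le ht.1]
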